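/- **Lemma 3.1.** Let $n\ge 1$ and let $g:\mathbb R^n\to[1,\infty)$ be a locally bounded, Borel measurable, submultiplicative function (i.e. $g(x+y)\le K g(x)g(y)$ for all $x,y\in\mathbb R^n$, with a constant $K\ge 1$) satisfying the Beurling–Domar condition $$\sum_{l=1}^\infty \frac{\log g(lx)}{l^2}<\infty\quad\text{for all }x\in\mathbb R^n .$$ Put $$S_g(r):=\sup_{x\in\mathbb R^n,\ |x|=1}\ \frac1\pi\int_{-\infty}^{\infty}\frac{\log g(\tau x)}{\tau^2+\max\{r,1\}^2}\,d\tau ,$$ and, for $1\le p\le\infty$ and a weight $\omega:\mathbb R^n\to(0,\infty)$, let $\|f\|_{L^p_\omega}:=\|\omega f\|_{L^p(\mathbb R^n)}$ and let $L^p_\omega(\mathbb R^n)$ be the set of all Lebesgue measurable $f:\mathbb R^n\to\mathbb C$ with $\|f\|_{L^p_\omega}<\infty$. Then $S_g(r)<\infty$ for all $r$, and there is a constant $C_g<\infty$ depending only on $g$ such that the following holds for every $1\le p\le\infty$ and for each choice of the sign in $g^{\pm1}$ (the same sign throughout). Let $\varphi(z_1,x')$ be a complex-valued Lebesgue measurable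 function on $\{z_1\in\mathbb C:\operatorname{Im}z_1\ge 0\}\times\mathbb R^{n-1}$ such that * for almost every $x'\in\mathbb R^{n-1}$, $\varphi(\cdot,x')$ is analytic in $\{\operatorname{Im}z_1>0\}$ and continuous on $\{\operatorname{Im}z_1\ge0\}$; * for almost every $x'\in\mathbb R^{n-1}$ there are $A,R\in\mathbb R$ (which may depend on $x'$) with $\log|\varphi(z_1,x')|\le A|z_1|$ whenever $\operatorname{Im}z_1\ge0$ and $|z_1|\ge R$; * the restriction of $\varphi$ to $\mathbb R^n=\mathbb R\times\mathbb R^{n-1}$ belongs to $L^p_{g^{\pm1}}(\mathbb R^n)$; * $\displaystyle k_\varphi:=\operatorname*{ess\,sup}_{x'\in\mathbb R^{n-1}}\Big(\limsup_{0<y_1\to\infty}\frac{\log|\varphi(iy_1,x')|}{y_1}\Big)<\infty$, where $\log 0:=-\infty$. Then for every $y_1>0$ the function $x=(x_1,x')\mapsto\varphi(x_1+iy_1,x')$ belongs to $L^p_{g^{\pm1}}(\mathbb R^n)$ and $$\|\varphi(\cdot+iy_1,\cdot)\|_{L^p_{g^{\pm1}}(\mathbb R^n)}\le C_g\,e^{(k_\varphi+S_g(y_1))y_1}\,\|\varphi\|_{L^p_{g^{\pm1}}(\mathbb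 R^n)}$$ (with $e^{-\infty}:=0$ if $k_\varphi=-\infty$). -/

import Mathlib

open MeasureTheory Filter Topology
open scoped ENNReal NNReal

/-- `g` is submultiplicative: `g (x + y) ≤ K * g x * g y` for some constant `K ≥ 1`. -/
def IsSubmultiplicative {n : ℕ} (g : EuclideanSpace ℝ (Fin n) → ℝ) : Prop :=
  ∃ K : ℝ, 1 ≤ K ∧ ∀ x y, g (x + y) ≤ K * g x * g y

/-- Every point has a neighbourhood on which `g` is bounded. -/
def IsLocallyBounded {n : ℕ} (g : EuclideanSpace ℝ (Fin n) → ℝ) : Prop :=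
  ∀ x, ∃ U ∈ 𝓝 x, ∃ B : ℝ, ∀ y ∈ U, |g y| ≤ B

/-- The Beurling–Domar condition: `∑_{l ≥ 1} log g(l x) / l² < ∞` for every `x`
(the term `l = 0` of the series below is `0`, and all terms are nonnegative when `g ≥ 1`). -/
def BeurlingDomar {n : ℕ} (g : EuclideanSpace ℝ (Fin n) → ℝ) : Prop :=
  ∀ x, Summable fun l : ℕ => Real.log (g ((l : ℝ) • x)) / (l : ℝ) ^ 2

/-- `S_g(r) = sup_{|x| = 1} (1/π) ∫_ℝ log g(τ x) / (τ² + max{r, 1}²) dτ`, for a weight `g ≥ 1`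
(so that the integrand is nonnegative), with values in `[0, ∞]`. -/
noncomputable def weightS {n : ℕ} (g : EuclideanSpace ℝ (Fin n) → ℝ) (r : ℝ) : ℝ≥0∞ :=
  ⨆ x ∈ Metric.sphere (0 : EuclideanSpace ℝ (Fin n)) 1,
    ENNReal.ofReal (1 / Real.pi) *
      ∫⁻ τ : ℝ, ENNReal.ofReal (Real.log (g (τ • x)) / (τ ^ 2 + max r 1 ^ 2))

/-- The weighted norm `‖f‖_{L^p_ω} = ‖ω f‖_{L^p}` on `ℝⁿ`. -/
noncomputable def wLpNorm {n : ℕ} (ω : EuclideanSpace ℝ (Fin n) → ℝ) (p : ℝ≥0∞)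
    (f : EuclideanSpace ℝ (Fin n) → ℂ) : ℝ≥0∞ :=
  eLpNorm (fun x => (ω x : ℂ) * f x) p volume

/-- Membership in `L^p_ω(ℝⁿ)`: `f` is (Lebesgue) measurable and `‖f‖_{L^p_ω} < ∞`. -/
def MemWLp {n : ℕ} (ω : EuclideanSpace ℝ (Fin n) → ℝ) (p : ℝ≥0∞)
    (f : EuclideanSpace ℝ (Fin n) → ℂ) : Prop :=
  AEStronglyMeasurable f volume ∧ wLpNorm ω p f < ∞

/-- The function `x = (x₁, x') ↦ φ(x₁ + i y, x')` on `ℝⁿ`, where `n = m + 1`; for `y = 0` it is the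
restriction of `φ` to `ℝⁿ`. -/
noncomputable def shiftRestrict {m : ℕ} (φ : ℂ → (Fin m → ℝ) → ℂ) (y : ℝ) :
    EuclideanSpace ℝ (Fin (m + 1)) → ℂ :=
  fun x => φ ((x 0 : ℂ) + (y : ℂ) * Complex.I) (fun j => x j.succ)

/-- `k_φ = ess sup_{x'} limsup_{y → +∞} log |φ(i y, x')| / y`, in `[-∞, ∞]`, with `log 0 = -∞`. -/
noncomputable def expType {m : ℕ} (φ : ℂ → (Fin m → ℝ) → ℂ) : EReal :=
  essSup (fun x' : Fin m → ℝ =>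
    limsup (fun y : ℝ => ENNReal.log ‖φ ((y : ℂ) * Complex.I) x'‖ₑ / (y : EReal)) atTop) volume

/-! Fix `x'` outside a null set and put `f = φ(·, x')`, `G(t) = g(t, x')^{±1}`, and write `P` for
the Poisson integral in the upper half-plane. A function of exponential type satisfies `log |f(z)| ≤
k Im z + P[log |f|](z)` for `k > k_φ`. Writing `|f| = q / G` with `q = G |f|` on the real line and
applying Jensen's inequality `exp P[log q] ≤ P[q]` gives, for `z = x + iy`, `G(x) |f(z)| ≤ exp (k y
+ log G(x) - P[log G](z)) · P[q](z)`.

Submultiplicativity bounds the oscillation of `log G` along the line by `log K + log g(±τ e₁)`, and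
the Poisson integral of this bound at height `y` is at most a constant plus `S_g(y) y`
(`log_zpow_weight_sub_hpIntegral_le`). Since `P` is an `L^p` contraction on horizontal lines
(`eLpNorm_le_of_le_lintegral_hpKernel`), integrating over `x'` and letting `k` decrease to `k_φ`
gives the estimate.

The majorant (`norm_le_exp_hpIntegral`) comes from Phragmén–Lindelöf: `P[u]` is the real part of an
analytic `W`, and `f exp (-W + ikz)` is bounded on the imaginary axis with boundary upper limits at
most one. A logarithm bounded below is treated first, then truncation is removed.

Finiteness of `S_g` needs uniformity over directions. The Beurling–Domar condition gives one
convergent integral per ray; expanding a unit vector in the standard basis reduces all directions to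
the finitely many rays `±e_j`. -/

/-! ### Maximum modulus and Phragmén–Lindelöf principles -/

/-- Maximum modulus principle on a bounded open set, in terms of the boundary upper limits. -/
theorem norm_le_of_limsup_frontier {U : Set ℂ} (hb : Bornology.IsBounded U) (ho : IsOpen U)
    (hc : IsPreconnected U) {F : ℂ → ℂ} (hd : DifferentiableOn ℂ F U) {C : ℝ}
    (h : ∀ ζ ∈ frontier U, ∀ ε > 0, ∀ᶠ z in 𝓝[U] ζ, ‖F z‖ ≤ C + ε) :
    ∀ z ∈ U, ‖F z‖ ≤ C := by
  intro z₁ hz₁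
  by_contra! hlt
  set c := ‖F z₁‖ with hcdef
  -- Near the frontier `‖F‖` is at most `(c + C) / 2 < c`, so this superlevel set is compact and
  -- `‖F‖` attains its maximum over `U` on it.
  let S : Set ℂ := {z | z ∈ U ∧ c ≤ ‖F z‖}
  have hS : IsClosed S := by
    refine isClosed_of_closure_subset fun ζ hζ => ?_
    have hζU : ζ ∈ closure U := closure_mono (fun z hz => hz.1) hζ
    have hne : (𝓝[S] ζ).NeBot := mem_closure_iff_nhdsWithin_neBot.1 hζ
    have hSU : 𝓝[S] ζ ≤ 𝓝[U] ζ := nhdsWithin_mono _ fun z hz => hz.1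
    have hSmem : ∀ᶠ z in 𝓝[S] ζ, c ≤ ‖F z‖ :=
      eventually_nhdsWithin_of_forall fun z hz => hz.2
    by_cases hU : ζ ∈ U
    · refine ⟨hU, ?_⟩
      have hcont : Tendsto (fun z => ‖F z‖) (𝓝[S] ζ) (𝓝 ‖F ζ‖) :=
        ((hd.continuousOn ζ hU).norm).mono_left hSU
      exact ge_of_tendsto hcont hSmem
    · have hf : ζ ∈ frontier U := by
        rw [frontier, ho.interior_eq]; exact ⟨hζU, hU⟩
      have h1 := hSU (h ζ hf ((c - C) / 2) (by linarith))
      obtain ⟨z, hz, hz'⟩ := (hSmem.and h1).exists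
      linarith
  have hScomp : IsCompact S :=
    Metric.isCompact_of_isClosed_isBounded hS (hb.subset fun z hz => hz.1)
  obtain ⟨w, hwS, hw⟩ := hScomp.exists_isMaxOn ⟨z₁, hz₁, le_rfl⟩
    ((hd.continuousOn.mono fun z hz => hz.1).norm)
  have hmax : IsMaxOn (norm ∘ F) U w := by
    intro z hz
    by_cases hzc : c ≤ ‖F z‖
    · exact hw ⟨hz, hzc⟩
    · exact (not_le.1 hzc).le.trans hwS.2
  have hconst := Complex.norm_eqOn_of_isPreconnected_of_isMaxOn hc ho hd hwS.1 hmax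
  -- The strong maximum principle makes `‖F‖` constant, so `U` is closed as well as open; a nonempty
  -- bounded set in the connected plane cannot be both.
  have hUS : U = S := by
    refine Set.Subset.antisymm (fun z hz => ⟨hz, ?_⟩) fun z hz => hz.1
    have := hconst hz
    simp only [Function.comp, Function.const] at this
    rw [this]; exact hwS.2
  have hclopen : IsClopen U := ⟨hUS ▸ hS, ho⟩
  rcases isClopen_iff.1 hclopen with h0 | h0
  · rw [h0] at hz₁; exact hz₁
  · rw [h0] at hb
    exact NormedSpace.unbounded_univ ℝ ℂ hb

/-- Phragmén–Lindelöf principle in the first quadrant for functions of exponential type, in terms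
of the boundary upper limits. -/
theorem quadrant_norm_le_of_limsup {F : ℂ → ℂ} {A B C : ℝ} (hC : 0 < C)
    (hd : DifferentiableOn ℂ F {z | 0 < z.re ∧ 0 < z.im})
    (hgrowth : ∀ z : ℂ, 0 < z.re → 0 < z.im → ‖F z‖ ≤ B * Real.exp (A * ‖z‖))
    (hbdry : ∀ ζ : ℂ, 0 ≤ ζ.re → 0 ≤ ζ.im → ζ.re = 0 ∨ ζ.im = 0 → ∀ ε > 0,
      ∀ᶠ z in 𝓝[{z | 0 < z.re ∧ 0 < z.im}] ζ, ‖F z‖ ≤ C + ε) :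
    ∀ z : ℂ, 0 < z.re → 0 < z.im → ‖F z‖ ≤ C := by
  set Q : Set ℂ := {z | 0 < z.re ∧ 0 < z.im} with hQ
  have hQo : IsOpen Q :=
    (isOpen_lt continuous_const Complex.continuous_re).inter
      (isOpen_lt continuous_const Complex.continuous_im)
  have hQc : Convex ℝ Q :=
    (convex_halfSpace_re_gt 0).inter (convex_halfSpace_im_gt 0)
  set κ := Real.cos (3 * Real.pi / 8) with hκdef
  have hκ : 0 < κ := Real.cos_pos_of_mem_Ioo ⟨by linarith [Real.pi_pos], by linarith [Real.pi_pos]⟩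
  -- This is `z^{3/2}` rotated by `-3π/8`, so its argument stays within `±3π/8` on the quadrant and
  -- its real part dominates `|z|^{3/2}`. The exponent exceeds the order one of `F` and stays below
  -- the critical order two.
  let E : ℂ → ℂ := fun z =>
    Complex.exp ((3 / 2 : ℝ) * Complex.log z - (3 * Real.pi / 8 : ℝ) * Complex.I)
  have hEd : DifferentiableOn ℂ E Q := by
    intro z hz
    have : z ∈ Complex.slitPlane := Or.inl hz.1
    refine DifferentiableAt.differentiableWithinAt ?_
    exact (((Complex.differentiableAt_log this).const_mul _).sub_const _).cexp
  have hEre : ∀ z ∈ Q, κ * ‖z‖ ^ (3 / 2 : ℝ) ≤ (E z).re := by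
    intro z hz
    have hz0 : z ≠ 0 := by rintro rfl; simp [hQ] at hz
    have harg0 : 0 ≤ z.arg := Complex.arg_nonneg_iff.2 hz.2.le
    have harg1 : z.arg ≤ Real.pi / 2 := (Complex.arg_le_pi_div_two_iff).2 (Or.inl hz.1.le)
    simp only [E, Complex.exp_re, Complex.sub_re, Complex.sub_im, Complex.re_ofReal_mul,
      Complex.im_ofReal_mul, Complex.log_re, Complex.log_im, Complex.I_re, Complex.I_im]
    have h1 : Real.exp (3 / 2 * Real.log ‖z‖ - 3 * Real.pi / 8 * 0) = ‖z‖ ^ (3 / 2 : ℝ) := by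
      rw [Real.rpow_def_of_pos (norm_pos_iff.2 hz0)]; ring_nf
    rw [h1, mul_comm κ]
    refine mul_le_mul_of_nonneg_left ?_ (by positivity)
    rw [← Real.cos_abs (_ - _)]
    refine Real.cos_le_cos_of_nonneg_of_le_pi (abs_nonneg _) (by linarith [Real.pi_pos]) ?_
    rw [abs_le]; constructor <;> linarith
  intro z₀ hz₀re hz₀im
  have key : ∀ ε > 0, ‖F z₀ * Complex.exp (-(ε : ℝ) * E z₀)‖ ≤ C := by
    intro ε hε
    have hGnorm : ∀ z ∈ Q, ‖F z * Complex.exp (-(ε : ℝ) * E z)‖ ≤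
        ‖F z‖ * Real.exp (-ε * (κ * ‖z‖ ^ (3 / 2 : ℝ))) := by
      intro z hz
      rw [norm_mul, Complex.norm_exp]
      gcongr
      have : (-(ε : ℂ) * E z).re = -ε * (E z).re := by
        rw [← Complex.ofReal_neg, Complex.re_ofReal_mul]
      rw [this]
      have := hEre z hz
      nlinarith
    have hlim : Tendsto (fun R : ℝ => B * Real.exp (A * R - ε * (κ * R ^ (3 / 2 : ℝ)))) atTop (𝓝 0) := by
      have h1 : Tendsto (fun R : ℝ => ε * (κ * R ^ (3 / 2 : ℝ)) - A * R) atTop atTop := by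
        have h2 : Tendsto (fun R : ℝ => ε * κ * R ^ (1 / 2 : ℝ) - A) atTop atTop :=
          tendsto_atTop_add_const_right _ _
            ((tendsto_rpow_atTop (by norm_num)).const_mul_atTop (by positivity))
        refine (tendsto_id.atTop_mul_atTop₀ h2).congr' ?_
        filter_upwards [eventually_gt_atTop 0] with R hR
        have : R ^ (3 / 2 : ℝ) = R * R ^ (1 / 2 : ℝ) := by
          rw [show (3 / 2 : ℝ) = 1 + 1 / 2 by norm_num, Real.rpow_add hR, Real.rpow_one]
        rw [this, id]; ring
      have h3 := (Real.tendsto_exp_neg_atTop_nhds_zero.comp h1).const_mul B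
      rw [mul_zero] at h3
      refine h3.congr fun R => ?_
      simp only [Function.comp]
      congr 2; ring
    -- The radius is taken so large that the damped function is below `C` on the arc `|z| = R`; on
    -- the two edges the damping factor is at most one.
    obtain ⟨R, hRC, hRz⟩ :=
      ((hlim.eventually (gt_mem_nhds hC)).and (eventually_gt_atTop (max ‖z₀‖ 0))).exists
    have hR0 : 0 < R := lt_of_le_of_lt (le_max_right _ _) hRz
    refine norm_le_of_limsup_frontier (U := Q ∩ Metric.ball 0 R)
      (F := fun z => F z * Complex.exp (-(ε : ℝ) * E z))
      (Metric.isBounded_ball.subset Set.inter_subset_right) (hQo.inter Metric.isOpen_ball)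
      ((hQc.inter (convex_ball _ _)).isPreconnected) ?_ ?_ z₀
      ⟨⟨hz₀re, hz₀im⟩, by simpa using lt_of_le_of_lt (le_max_left _ _) hRz⟩
    · exact ((hd.mul ((hEd.const_mul _).cexp)).mono Set.inter_subset_left)
    · intro ζ hζ η hη
      have hop : IsOpen (Q ∩ Metric.ball (0 : ℂ) R) := hQo.inter Metric.isOpen_ball
      rw [frontier, hop.interior_eq] at hζ
      have hre : 0 ≤ ζ.re := by
        have : closure (Q ∩ Metric.ball (0 : ℂ) R) ⊆ {z : ℂ | 0 ≤ z.re} :=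
          closure_minimal (fun z hz => hz.1.1.le) (isClosed_le continuous_const Complex.continuous_re)
        exact this hζ.1
      have him : 0 ≤ ζ.im := by
        have : closure (Q ∩ Metric.ball (0 : ℂ) R) ⊆ {z : ℂ | 0 ≤ z.im} :=
          closure_minimal (fun z hz => hz.1.2.le) (isClosed_le continuous_const Complex.continuous_im)
        exact this hζ.1
      have hnorm : ‖ζ‖ ≤ R := by
        have : closure (Q ∩ Metric.ball (0 : ℂ) R) ⊆ {z : ℂ | ‖z‖ ≤ R} :=
          closure_minimal (fun z hz => (mem_ball_zero_iff.1 hz.2).le)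
            (isClosed_le continuous_norm continuous_const)
        exact this hζ.1
      have hmono : 𝓝[Q ∩ Metric.ball 0 R] ζ ≤ 𝓝[Q] ζ := nhdsWithin_mono _ Set.inter_subset_left
      by_cases hζQ : ζ ∈ Q
      · have hζR : ‖ζ‖ = R := by
          refine le_antisymm hnorm (not_lt.1 fun hlt => hζ.2 ⟨hζQ, by simpa using hlt⟩)
        have hcont : Tendsto (fun z : ℂ => B * Real.exp (A * ‖z‖ - ε * (κ * ‖z‖ ^ (3 / 2 : ℝ))))
            (𝓝[Q] ζ) (𝓝 (B * Real.exp (A * ‖ζ‖ - ε * (κ * ‖ζ‖ ^ (3 / 2 : ℝ))))) := by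
          refine Tendsto.mono_left (Continuous.tendsto ?_ ζ) nhdsWithin_le_nhds
          have : Continuous fun z : ℂ => ‖z‖ ^ (3 / 2 : ℝ) :=
            continuous_norm.rpow_const fun _ => Or.inr (by norm_num)
          fun_prop
        rw [hζR] at hcont
        have hev := hcont.eventually (gt_mem_nhds (show _ < C + η by linarith))
        filter_upwards [hmono hev, hmono self_mem_nhdsWithin] with z hz hzQ
        refine (hGnorm z hzQ).trans (le_trans ?_ hz.le)
        refine (mul_le_mul_of_nonneg_right (hgrowth z hzQ.1 hzQ.2) (Real.exp_pos _).le).trans ?_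
        rw [mul_assoc, ← Real.exp_add]
        apply le_of_eq; congr 2; ring
      · have hor : ζ.re = 0 ∨ ζ.im = 0 := by
          by_contra! hcon
          exact hζQ ⟨lt_of_le_of_ne hre hcon.1.symm, lt_of_le_of_ne him hcon.2.symm⟩
        filter_upwards [hmono (hbdry ζ hre him hor η hη), hmono self_mem_nhdsWithin] with z hz hzQ
        refine (hGnorm z hzQ).trans (le_trans ?_ hz)
        refine mul_le_of_le_one_right (norm_nonneg _) (Real.exp_le_one_iff.2 ?_)
        have : 0 ≤ κ * ‖z‖ ^ (3 / 2 : ℝ) := by positivity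
        nlinarith
  have hlim : Tendsto (fun ε : ℝ => ‖F z₀ * Complex.exp (-(ε : ℝ) * E z₀)‖) (𝓝[>] 0)
      (𝓝 ‖F z₀‖) := by
    have : Continuous fun ε : ℝ => ‖F z₀ * Complex.exp (-(ε : ℝ) * E z₀)‖ := by fun_prop
    have h := this.tendsto 0
    simp only [Complex.ofReal_zero, neg_zero, zero_mul, Complex.exp_zero, mul_one] at h
    exact h.mono_left nhdsWithin_le_nhds
  exact le_of_tendsto hlim (eventually_nhdsWithin_of_forall fun ε hε => key ε hε)

/-- Phragmén–Lindelöf principle in the upper half-plane for functions of exponential type that are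
bounded on the imaginary axis, in terms of the boundary upper limits. -/
theorem upperHalfPlane_norm_le_one_of_limsup {F : ℂ → ℂ} {A B M : ℝ}
    (hd : DifferentiableOn ℂ F {z | 0 < z.im})
    (hgrowth : ∀ z : ℂ, 0 < z.im → ‖F z‖ ≤ B * Real.exp (A * ‖z‖))
    (haxis : ∀ y : ℝ, 0 < y → ‖F (y * Complex.I)‖ ≤ M)
    (hbdry : ∀ x : ℝ, ∀ ε > 0, ∀ᶠ z in 𝓝[{z | 0 < z.im}] (x : ℂ), ‖F z‖ ≤ 1 + ε) :
    ∀ z : ℂ, 0 < z.im → ‖F z‖ ≤ 1 := by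
  set H : Set ℂ := {z | 0 < z.im} with hH
  have hHo : IsOpen H := isOpen_lt continuous_const Complex.continuous_im
  -- The half-plane is cut along the imaginary axis into two quadrants, where exponential type is
  -- subcritical; `C` bounds the limits on all edges. The bound is sharpened to one afterwards.
  set C := max M 1 with hC
  have hC0 : 0 < C := lt_of_lt_of_le one_pos (le_max_right _ _)
  have haxis' : ∀ ζ : ℂ, ζ.re = 0 → 0 < ζ.im → ∀ ε > 0, ∀ᶠ z in 𝓝 ζ, ‖F z‖ ≤ C + ε := by
    intro ζ h0 h1 ε hε
    have hcont : ContinuousAt (fun z => ‖F z‖) ζ :=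
      ((hd ζ h1).differentiableAt (hHo.mem_nhds h1)).continuousAt.norm
    have hle : ‖F ζ‖ < C + ε := by
      have := haxis ζ.im h1
      rw [show (ζ.im : ℂ) * Complex.I = ζ by apply Complex.ext <;> simp [h0]] at this
      linarith [le_max_left M 1]
    exact (hcont.eventually (gt_mem_nhds hle)).mono fun z hz => le_of_lt hz
  have hreal : ∀ x : ℝ, ∀ ε > 0, ∀ᶠ z in 𝓝[H] (x : ℂ), ‖F z‖ ≤ C + ε := fun x ε hε =>
    (hbdry x ε hε).mono fun z hz => hz.trans (by linarith [le_max_right M 1])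
  have hQ1 : ∀ z : ℂ, 0 < z.re → 0 < z.im → ‖F z‖ ≤ C := by
    refine quadrant_norm_le_of_limsup hC0 (hd.mono fun z hz => hz.2)
      (fun z _ hz => hgrowth z hz) fun ζ hre him hor ε hε => ?_
    rcases him.eq_or_lt with h0 | h0
    · have := hreal ζ.re ε hε
      rw [show (ζ.re : ℂ) = ζ by apply Complex.ext <;> simp [← h0]] at this
      exact nhdsWithin_mono _ (fun z hz => hz.2) this
    · exact nhdsWithin_le_nhds (haxis' ζ (hor.resolve_right h0.ne') h0 ε hε)
  have hQ2 : ∀ z : ℂ, 0 < z.re → 0 < z.im → ‖F (Complex.I * z)‖ ≤ C := by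
    have hmap : Set.MapsTo (fun z : ℂ => Complex.I * z) {z | 0 < z.re ∧ 0 < z.im} H := by
      intro z hz; simpa [hH] using hz.1
    have hcontI : Continuous fun z : ℂ => Complex.I * z := by fun_prop
    refine quadrant_norm_le_of_limsup (F := fun z => F (Complex.I * z)) hC0
      (hd.comp (by fun_prop) hmap)
      (fun z hz _ => by simpa using hgrowth (Complex.I * z) (by simpa using hz))
      fun ζ hre him hor ε hε => ?_
    rcases hre.eq_or_lt with h0 | h0
    · have h1 := hreal (-ζ.im) ε hε
      rw [show ((-ζ.im : ℝ) : ℂ) = Complex.I * ζ by apply Complex.ext <;> simp [← h0]] at h1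
      exact (hcontI.continuousWithinAt.tendsto_nhdsWithin hmap).eventually h1
    · have h1 := haxis' (Complex.I * ζ) (by simpa using hor.resolve_left h0.ne') (by simpa using h0)
        ε hε
      exact nhdsWithin_le_nhds ((hcontI.tendsto ζ).eventually h1)
  have hbound : ∀ z : ℂ, 0 < z.im → ‖F z‖ ≤ C := by
    intro z hz
    rcases lt_trichotomy z.re 0 with h | h | h
    · have := hQ2 (-Complex.I * z) (by simpa using hz) (by simpa using h)
      rwa [← mul_assoc, show Complex.I * -Complex.I = 1 by simp, one_mul] at this
    · have := haxis z.im hz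
      rw [show (z.im : ℂ) * Complex.I = z by apply Complex.ext <;> simp [h]] at this
      exact this.trans (le_max_left _ _)
    · exact hQ1 z h hz
  intro z₀ hz₀
  have hden : ∀ ε : ℝ, 0 < ε → ∀ z ∈ H, 1 ≤ ‖Complex.I + ε * z‖ := by
    intro ε hε z hz
    have h1 := Complex.abs_im_le_norm (Complex.I + ε * z)
    have hz' : 0 < z.im := hz
    have h2 : (Complex.I + ε * z).im = 1 + ε * z.im := by simp
    rw [h2, abs_of_pos (by positivity)] at h1
    nlinarith [mul_pos hε hz']
  -- The divisor has modulus at least one in the half-plane and at least `εR - 1 ≥ C` on the arc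
  -- `|z| = R`, so the quotient of the already bounded `F` is controlled by one on the whole
  -- frontier.
  have key : ∀ ε : ℝ, 0 < ε → ‖F z₀ / (Complex.I + ε * z₀)‖ ≤ 1 := by
    intro ε hε
    set R := max (‖z₀‖ + 1) ((C + 1) / ε) with hR
    have hRz : ‖z₀‖ < R := by linarith [le_max_left (‖z₀‖ + 1) ((C + 1) / ε)]
    have hRC : C + 1 ≤ ε * R := by
      have := le_max_right (‖z₀‖ + 1) ((C + 1) / ε)
      rw [div_le_iff₀ hε] at this; linarith
    have hop : IsOpen (H ∩ Metric.ball (0 : ℂ) R) := hHo.inter Metric.isOpen_ball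
    refine norm_le_of_limsup_frontier (U := H ∩ Metric.ball 0 R)
      (F := fun z => F z / (Complex.I + ε * z))
      (Metric.isBounded_ball.subset Set.inter_subset_right) hop
      (((convex_halfSpace_im_gt 0).inter (convex_ball _ _)).isPreconnected) ?_ ?_ z₀
      ⟨hz₀, by simpa using hRz⟩
    · refine (hd.mono Set.inter_subset_left).div (by fun_prop) fun z hz => ?_
      exact norm_pos_iff.1 (one_pos.trans_le (hden ε hε z hz.1))
    · intro ζ hζ η hη
      rw [frontier, hop.interior_eq] at hζ
      have him : 0 ≤ ζ.im := by
        have : closure (H ∩ Metric.ball (0 : ℂ) R) ⊆ {z : ℂ | 0 ≤ z.im} :=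
          closure_minimal (fun z hz => show 0 ≤ z.im from le_of_lt hz.1)
            (isClosed_le continuous_const Complex.continuous_im)
        exact this hζ.1
      have hmono : 𝓝[H ∩ Metric.ball 0 R] ζ ≤ 𝓝[H] ζ := nhdsWithin_mono _ Set.inter_subset_left
      rcases him.eq_or_lt with h0 | h0
      · have h1 := hbdry ζ.re η hη
        rw [show (ζ.re : ℂ) = ζ by apply Complex.ext <;> simp [← h0]] at h1
        filter_upwards [hmono h1, hmono self_mem_nhdsWithin] with z hz hzH
        rw [norm_div]
        exact (div_le_self (norm_nonneg _) (hden ε hε z hzH)).trans hz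
      · have hζR : R ≤ ‖ζ‖ := not_lt.1 fun hlt => hζ.2 ⟨h0, by simpa using hlt⟩
        have hbig : C < ‖Complex.I + ε * ζ‖ * (1 + η) := by
          have h2 : ‖(ε : ℂ) * ζ‖ - ‖Complex.I‖ ≤ ‖Complex.I + ε * ζ‖ := by
            have := norm_sub_norm_le ((ε : ℂ) * ζ) (-Complex.I)
            rwa [norm_neg, sub_neg_eq_add, add_comm ((ε : ℂ) * ζ)] at this
          rw [norm_mul, Complex.norm_real, Complex.norm_I, Real.norm_of_nonneg hε.le] at h2
          have h3 : ε * R ≤ ε * ‖ζ‖ := by gcongr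
          nlinarith
        have hcont : Tendsto (fun z : ℂ => ‖Complex.I + ε * z‖ * (1 + η)) (𝓝 ζ)
            (𝓝 (‖Complex.I + ε * ζ‖ * (1 + η))) := by
          refine Continuous.tendsto (by fun_prop) ζ
        filter_upwards [nhdsWithin_le_nhds (hcont.eventually (lt_mem_nhds hbig)),
          hmono self_mem_nhdsWithin] with z hz hzH
        rw [norm_div, div_le_iff₀ (one_pos.trans_le (hden ε hε z hzH))]
        linarith [hbound z hzH]
  have hlim : Tendsto (fun ε : ℝ => ‖F z₀ / (Complex.I + ε * z₀)‖) (𝓝[>] 0) (𝓝 ‖F z₀‖) := by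
    have : ContinuousAt (fun ε : ℝ => ‖F z₀ / (Complex.I + ε * z₀)‖) 0 := by
      refine (ContinuousAt.div (by fun_prop) (by fun_prop) ?_).norm
      simp
    have h := this.tendsto
    simp only [Complex.ofReal_zero, zero_mul, add_zero, norm_div, Complex.norm_I, div_one] at h
    simp only [norm_div]
    exact h.mono_left nhdsWithin_le_nhds
  exact le_of_tendsto hlim (eventually_nhdsWithin_of_forall fun ε hε => key ε hε)

/-! ### Poisson kernel and Poisson integrals -/

/-- The Poisson kernel of the upper half-plane. -/
noncomputable def hpKernel (y t : ℝ) : ℝ := Real.pi⁻¹ * (y / (t ^ 2 + y ^ 2))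

theorem hpKernel_nonneg {y : ℝ} (hy : 0 ≤ y) (t : ℝ) : 0 ≤ hpKernel y t := by
  unfold hpKernel; positivity

theorem hpKernel_neg (y t : ℝ) : hpKernel y (-t) = hpKernel y t := by
  simp [hpKernel]

theorem hpKernel_sub_comm (y s t : ℝ) : hpKernel y (s - t) = hpKernel y (t - s) := by
  rw [← hpKernel_neg, neg_sub]

@[fun_prop]
theorem measurable_hpKernel (y : ℝ) : Measurable (hpKernel y) := by
  unfold hpKernel; fun_prop

theorem hpKernel_eq_cauchyPDFReal {y : ℝ} (hy : 0 < y) (x t : ℝ) :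
    hpKernel y (t - x) = ProbabilityTheory.cauchyPDFReal x y.toNNReal t := by
  rw [ProbabilityTheory.cauchyPDFReal_def, hpKernel, Real.coe_toNNReal y hy.le]
  ring

theorem integrable_hpKernel {y : ℝ} (hy : 0 < y) (x : ℝ) :
    Integrable fun t => hpKernel y (t - x) := by
  simp only [hpKernel_eq_cauchyPDFReal hy]
  exact ProbabilityTheory.integrable_cauchyPDFReal x

theorem integral_hpKernel {y : ℝ} (hy : 0 < y) (x : ℝ) : ∫ t, hpKernel y (t - x) = 1 := by
  simp only [hpKernel_eq_cauchyPDFReal hy]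
  exact ProbabilityTheory.integral_cauchyPDFReal_eq_one x (Real.toNNReal_pos.2 hy).ne'

theorem lintegral_hpKernel {y : ℝ} (hy : 0 < y) (x : ℝ) :
    ∫⁻ t, ENNReal.ofReal (hpKernel y (t - x)) = 1 := by
  rw [← ofReal_integral_eq_lintegral_ofReal (integrable_hpKernel hy x)
    (ae_of_all _ fun t => hpKernel_nonneg hy.le _), integral_hpKernel hy, ENNReal.ofReal_one]

/-- Since `|t - z| ≥ η`, both `|t| ≤ |t - z| + ρ` and `1` are multiples of `|t - z|`. The constant
depends only on `ρ` and `η`, which allows domination uniformly for `z` in a small disc. -/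
theorem one_add_sq_le_mul_of_im {ρ η : ℝ} (hη : 0 < η) (hρ : 0 ≤ ρ) {z : ℂ} (hz : ‖z‖ ≤ ρ)
    (him : η ≤ z.im) (t : ℝ) :
    1 + t ^ 2 ≤ ((1 + ρ / η) ^ 2 + (1 / η) ^ 2) * ‖(t : ℂ) - z‖ ^ 2 := by
  have h1 : η ≤ ‖(t : ℂ) - z‖ := by
    have := Complex.abs_im_le_norm ((t : ℂ) - z)
    simp only [Complex.sub_im, Complex.ofReal_im, zero_sub, abs_neg] at this
    exact him.trans ((le_abs_self _).trans this)
  set N := ‖(t : ℂ) - z‖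
  have h2 : |t| ≤ N + ρ := by
    have := norm_add_le ((t : ℂ) - z) z
    simp only [sub_add_cancel, Complex.norm_real, Real.norm_eq_abs] at this
    linarith
  have h3 : |t| ≤ (1 + ρ / η) * N := by
    have : ρ ≤ ρ / η * N := by
      rw [div_mul_eq_mul_div, le_div_iff₀ hη]; gcongr
    linarith
  have h4 : 1 ≤ 1 / η * N := by
    rw [div_mul_eq_mul_div, le_div_iff₀ hη]; linarith
  have h5 : t ^ 2 ≤ ((1 + ρ / η) * N) ^ 2 := by
    rw [← sq_abs]; gcongr
  have h6 : 1 ≤ (1 / η * N) ^ 2 := by nlinarith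
  nlinarith

theorem norm_ofReal_sub_sq (t : ℝ) (z : ℂ) :
    ‖(t : ℂ) - z‖ ^ 2 = (t - z.re) ^ 2 + z.im ^ 2 := by
  rw [← Complex.normSq_eq_norm_sq, Complex.normSq_apply]
  simp; ring

/-- The Poisson kernel at a point is dominated by `(1 + t²)⁻¹`. -/
theorem exists_hpKernel_le {y : ℝ} (hy : 0 < y) (x : ℝ) :
    ∃ c : ℝ, 0 ≤ c ∧ ∀ t, hpKernel y (t - x) ≤ c * (1 + t ^ 2)⁻¹ := by
  set z : ℂ := ⟨x, y⟩
  set c₀ := (1 + ‖z‖ / y) ^ 2 + (1 / y) ^ 2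
  refine ⟨Real.pi⁻¹ * (y * c₀), by positivity, fun t => ?_⟩
  have h := one_add_sq_le_mul_of_im hy (norm_nonneg z) le_rfl le_rfl t
  rw [norm_ofReal_sub_sq] at h
  change 1 + t ^ 2 ≤ c₀ * ((t - x) ^ 2 + y ^ 2) at h
  unfold hpKernel
  rw [mul_assoc, mul_assoc]
  gcongr
  rw [div_eq_mul_inv]
  gcongr
  rw [inv_le_iff_one_le_mul₀ (by positivity), mul_comm c₀, mul_assoc, ← div_eq_inv_mul,
    le_div_iff₀ (by positivity), one_mul]
  exact h

/-- The Poisson kernel at a point dominates a multiple of `(1 + t²)⁻¹`. -/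
theorem exists_le_hpKernel {y : ℝ} (hy : 0 < y) (x : ℝ) :
    ∃ c : ℝ, 0 < c ∧ ∀ t, c * (1 + t ^ 2)⁻¹ ≤ hpKernel y (t - x) := by
  refine ⟨Real.pi⁻¹ * (y / (2 + 2 * x ^ 2 + y ^ 2)), by positivity, fun t => ?_⟩
  unfold hpKernel
  rw [mul_assoc]
  gcongr
  rw [← div_eq_mul_inv, div_div]
  gcongr
  nlinarith [sq_nonneg (t + x), mul_nonneg (sq_nonneg t) (sq_nonneg x),
    mul_nonneg (sq_nonneg t) (sq_nonneg y), sq_nonneg t, sq_nonneg x, sq_nonneg y]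

theorem integrable_mul_hpKernel {u : ℝ → ℝ} (hu : Integrable fun t => u t * (1 + t ^ 2)⁻¹)
    {y : ℝ} (hy : 0 < y) (x : ℝ) : Integrable fun t => u t * hpKernel y (t - x) := by
  obtain ⟨c, hc, h⟩ := exists_hpKernel_le hy x
  have hm : AEStronglyMeasurable u volume := by
    have h1 : AEStronglyMeasurable (fun t : ℝ => 1 + t ^ 2) volume := by fun_prop
    refine (hu.1.mul h1).congr (ae_of_all _ fun t => ?_)
    have : (1 + t ^ 2) ≠ 0 := by positivity
    simp [this]
  refine (hu.const_mul c).mono (hm.mul (Measurable.aestronglyMeasurable (by fun_prop)))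
    (ae_of_all _ fun t => ?_)
  have h0 := hpKernel_nonneg hy.le (t - x)
  rw [norm_mul, norm_mul, norm_mul, Real.norm_of_nonneg h0, Real.norm_of_nonneg hc,
    Real.norm_of_nonneg (show 0 ≤ (1 + t ^ 2)⁻¹ by positivity)]
  calc ‖u t‖ * hpKernel y (t - x) ≤ ‖u t‖ * (c * (1 + t ^ 2)⁻¹) := by gcongr; exact h t
    _ = _ := by ring

/-- Kernels at different points are comparable, so finiteness of a Poisson integral at a single
point yields integrability at all of them. -/
theorem integrable_mul_inv_of_hpKernel {u : ℝ → ℝ} {y : ℝ} (hy : 0 < y) (x : ℝ)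
    (hu : Integrable fun t => u t * hpKernel y (t - x)) :
    Integrable fun t => u t * (1 + t ^ 2)⁻¹ := by
  obtain ⟨c, hc, h⟩ := exists_le_hpKernel hy x
  have hpos : ∀ t, 0 < hpKernel y (t - x) := fun t => lt_of_lt_of_le (by positivity) (h t)
  have hm : AEStronglyMeasurable u volume := by
    have h1 : AEStronglyMeasurable (fun t : ℝ => (hpKernel y (t - x))⁻¹) volume :=
      Measurable.aestronglyMeasurable (by fun_prop)
    refine (hu.1.mul h1).congr (ae_of_all _ fun t => ?_)
    simp [(hpos t).ne']
  have hm2 : AEStronglyMeasurable (fun t : ℝ => (1 + t ^ 2)⁻¹) volume :=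
    Measurable.aestronglyMeasurable (by fun_prop)
  refine (hu.const_mul c⁻¹).mono (hm.mul hm2) (ae_of_all _ fun t => ?_)
  rw [norm_mul, norm_mul, norm_mul, Real.norm_of_nonneg (hpos t).le,
    Real.norm_of_nonneg (inv_pos.2 hc).le,
    Real.norm_of_nonneg (show 0 ≤ (1 + t ^ 2)⁻¹ by positivity)]
  rw [mul_left_comm]
  gcongr
  rw [← div_eq_inv_mul, le_div_iff₀ hc, mul_comm]
  exact h t

/-- The Poisson integral of `u` at the point `z` of the upper half-plane. -/
noncomputable def hpIntegral (u : ℝ → ℝ) (z : ℂ) : ℝ := ∫ t, u t * hpKernel z.im (t - z.re)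

/-- A Poisson integral is the real part of an analytic function. -/
theorem exists_differentiableOn_re_eq_hpIntegral {w : ℝ → ℝ}
    (hw : Integrable fun t => w t * (1 + t ^ 2)⁻¹) :
    ∃ W : ℂ → ℂ, DifferentiableOn ℂ W {z | 0 < z.im} ∧ ∀ z : ℂ, 0 < z.im →
      (W z).re = hpIntegral w z := by
  have hm : AEStronglyMeasurable w volume := by
    have h1 : AEStronglyMeasurable (fun t : ℝ => 1 + t ^ 2) volume := by fun_prop
    refine (hw.1.mul h1).congr (ae_of_all _ fun t => ?_)
    have : (1 + t ^ 2) ≠ 0 := by positivity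
    simp [this]
  have hmC : AEStronglyMeasurable (fun t => (w t : ℂ)) volume :=
    Complex.continuous_ofReal.comp_aestronglyMeasurable hm
  -- The Cauchy kernel decays only like `1/t`; subtracting `t/(1 + t²)` improves this to `1/t²`. The
  -- subtracted term is real, so the imaginary part is still `π` times the Poisson kernel.
  let Φ : ℂ → ℝ → ℂ := fun z t => (w t : ℂ) * (((t : ℂ) - z)⁻¹ - ((t / (1 + t ^ 2) : ℝ) : ℂ))
  let Φ' : ℂ → ℝ → ℂ := fun z t => (w t : ℂ) * (((t : ℂ) - z) ^ 2)⁻¹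
  have hne : ∀ z : ℂ, 0 < z.im → ∀ t : ℝ, (t : ℂ) - z ≠ 0 := by
    intro z hz t h
    have := congrArg Complex.im h
    simp at this; linarith
  have hΦm : ∀ z, AEStronglyMeasurable (Φ z) volume := fun z =>
    hmC.mul (Measurable.aestronglyMeasurable (by fun_prop))
  have hΦ'm : ∀ z, AEStronglyMeasurable (Φ' z) volume := fun z =>
    hmC.mul (Measurable.aestronglyMeasurable (by fun_prop))
  have hΦi : ∀ z : ℂ, 0 < z.im → Integrable (Φ z) := by
    intro z hz
    set c := (1 + ‖z‖ / z.im) ^ 2 + (1 / z.im) ^ 2 with hc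
    have hc0 : 0 < c := by positivity
    refine (hw.const_mul (c * ‖z‖ + 2 * c + 1 )).mono (hΦm z) (ae_of_all _ fun t => ?_)
    have h := one_add_sq_le_mul_of_im hz (norm_nonneg z) le_rfl le_rfl t
    rw [← hc] at h
    set N := ‖(t : ℂ) - z‖ with hN
    have hN0 : 0 < N := norm_pos_iff.2 (hne z hz t)
    have hcc : ((1 + t ^ 2 : ℝ) : ℂ) ≠ 0 := by
      rw [Complex.ofReal_ne_zero]; positivity
    have hform : ((t : ℂ) - z)⁻¹ - ((t / (1 + t ^ 2) : ℝ) : ℂ) =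
        (1 + t * z) / (((t : ℂ) - z) * ((1 + t ^ 2 : ℝ) : ℂ)) := by
      have h1 := hne z hz t
      rw [Complex.ofReal_div]
      field_simp
      push_cast; ring
    have hnum : ‖1 + (t : ℂ) * z‖ ≤ N * (c * ‖z‖ + 2 * c + 1) := by
      have e : 1 + (t : ℂ) * z = (1 + z ^ 2) + ((t : ℂ) - z) * z := by ring
      have hz1 : z.im ≤ N := by
        have := Complex.abs_im_le_norm ((t : ℂ) - z)
        simp only [Complex.sub_im, Complex.ofReal_im, zero_sub, abs_neg] at this
        exact (le_abs_self _).trans this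
      have h1 : ‖1 + (t : ℂ) * z‖ ≤ 1 + |t| * ‖z‖ := by
        refine (norm_add_le _ _).trans ?_
        rw [norm_one, norm_mul, Complex.norm_real, Real.norm_eq_abs]
      have hc1 : 1 ≤ (1 + ‖z‖ / z.im) ^ 2 := by
        have : 0 ≤ ‖z‖ / z.im := by positivity
        nlinarith
      have hcz : 1 + ‖z‖ / z.im ≤ c := by
        have : 0 ≤ ‖z‖ / z.im := by positivity
        have h2 : 0 ≤ (1 / z.im) ^ 2 := by positivity
        nlinarith
      have hcN : 1 ≤ (2 * c + 1) * N := by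
        have h2 : 1 / z.im ≤ 2 * c + 1 := by
          have h3 : (1 / z.im) ^ 2 ≤ c := by
            have : 0 ≤ (1 + ‖z‖ / z.im) ^ 2 := by positivity
            linarith
          nlinarith [sq_nonneg (1 / z.im - 1)]
        have h3 : 1 ≤ (2 * c + 1) * z.im := by rwa [div_le_iff₀ hz] at h2
        nlinarith
      have ht : |t| ≤ c * N := by
        have h2 : |t| ≤ N + ‖z‖ := by
          have := norm_add_le ((t : ℂ) - z) z
          simp only [sub_add_cancel, Complex.norm_real, Real.norm_eq_abs] at this
          linarith
        have h3 : ‖z‖ ≤ ‖z‖ / z.im * N := by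
          rw [div_mul_eq_mul_div, le_div_iff₀ hz]; gcongr
        nlinarith
      nlinarith [norm_nonneg z]
    have hw0 : (0 : ℝ) < 1 + t ^ 2 := by positivity
    simp only [Φ]
    rw [hform, norm_mul, norm_div, norm_mul, norm_mul, norm_mul, Complex.norm_real,
      Complex.norm_real, Real.norm_of_nonneg hw0.le, ← hN,
      Real.norm_of_nonneg (show 0 ≤ c * ‖z‖ + 2 * c + 1 by positivity),
      Real.norm_of_nonneg (show 0 ≤ (1 + t ^ 2)⁻¹ by positivity), mul_left_comm]
    gcongr
    rw [div_le_iff₀ (by positivity)]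
    calc ‖1 + (t : ℂ) * z‖ ≤ N * (c * ‖z‖ + 2 * c + 1) := hnum
      _ = _ := by field_simp
  have hderiv : ∀ z : ℂ, 0 < z.im → HasDerivAt (fun z => ∫ t, Φ z t) (∫ t, Φ' z t) z := by
    intro z₀ hz₀
    set η := z₀.im / 2 with hη
    have hη0 : 0 < η := by positivity
    set ρ := ‖z₀‖ + η with hρ
    have hρ0 : 0 ≤ ρ := by positivity
    set c := (1 + ρ / η) ^ 2 + (1 / η) ^ 2 with hc
    have hball : ∀ z ∈ Metric.ball z₀ η, ‖z‖ ≤ ρ ∧ η ≤ z.im := by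
      intro z hz
      rw [mem_ball_iff_norm] at hz
      constructor
      · have := norm_add_le (z - z₀) z₀
        rw [sub_add_cancel] at this; linarith
      · have := (Complex.abs_im_le_norm (z - z₀)).trans_lt hz
        rw [Complex.sub_im, abs_lt] at this
        linarith [this.1]
    refine (hasDerivAt_integral_of_dominated_loc_of_deriv_le (F := Φ) (F' := Φ')
      (bound := fun t => c * ‖w t * (1 + t ^ 2)⁻¹‖)
      (Metric.ball_mem_nhds z₀ hη0) (Eventually.of_forall hΦm) (hΦi z₀ hz₀) (hΦ'm z₀)
      (ae_of_all _ fun t z hz => ?_) (hw.norm.const_mul c) (ae_of_all _ fun t z hz => ?_)).2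
    · obtain ⟨h1, h2⟩ := hball z hz
      have h := one_add_sq_le_mul_of_im hη0 hρ0 h1 h2 t
      have hN0 : 0 < ‖(t : ℂ) - z‖ := norm_pos_iff.2 (hne z (hη0.trans_le h2) t)
      have hw0 : (0 : ℝ) < 1 + t ^ 2 := by positivity
      simp only [Φ']
      rw [norm_mul, norm_mul, norm_inv, norm_pow, Complex.norm_real,
        Real.norm_of_nonneg (show 0 ≤ (1 + t ^ 2)⁻¹ by positivity), mul_left_comm]
      gcongr
      rw [← div_eq_mul_inv, le_div_iff₀ hw0, ← div_eq_inv_mul, div_le_iff₀ (by positivity)]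
      exact h
    · obtain ⟨h1, h2⟩ := hball z hz
      have hz' := hne z (hη0.trans_le h2) t
      have hd : HasDerivAt (fun z : ℂ => (t : ℂ) - z) (-1) z := by
        simpa using (hasDerivAt_id z).const_sub (t : ℂ)
      have := ((hd.inv hz').sub_const ((t / (1 + t ^ 2) : ℝ) : ℂ)).const_mul (w t : ℂ)
      simpa [Φ, Φ'] using this
  refine ⟨fun z => (Real.pi : ℂ)⁻¹ * -Complex.I * ∫ t, Φ z t, fun z hz =>
    ((hderiv z hz).differentiableAt.const_mul _).differentiableWithinAt, fun z hz => ?_⟩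
  have h1 : ((Real.pi : ℂ)⁻¹ * -Complex.I * ∫ t, Φ z t).re = Real.pi⁻¹ * (∫ t, Φ z t).im := by
    rw [mul_assoc, ← Complex.ofReal_inv, Complex.re_ofReal_mul]
    simp
  have h2 : (∫ t, Φ z t).im = ∫ t, (Φ z t).im := (integral_im (𝕜 := ℂ) (hΦi z hz)).symm
  rw [h1, h2, hpIntegral, ← integral_const_mul]
  congr 1; ext t
  simp only [Φ, hpKernel]
  rw [Complex.im_ofReal_mul, Complex.sub_im, Complex.ofReal_im, Complex.inv_im,
    Complex.normSq_eq_norm_sq, norm_ofReal_sub_sq]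
  simp
  ring

/-- The substitution `t = x + y s` moves the dependence on the point from the kernel to the argument
of `h`; this serves both the boundary limit and the rescaling of rays. -/
theorem hpKernel_change {y : ℝ} (hy : 0 < y) (x : ℝ) (h : ℝ → ℝ) :
    ∫ t, h t * hpKernel y (t - x) = ∫ s, h (x + y * s) * (Real.pi⁻¹ * (1 + s ^ 2)⁻¹) := by
  have h1 := integral_add_left_eq_self (μ := volume) (fun t => h t * hpKernel y (t - x)) x
  rw [← h1]
  have h2 := Measure.integral_comp_mul_left (fun s => h (x + s) * hpKernel y (x + s - x)) y
  rw [abs_of_pos (inv_pos.2 hy), smul_eq_mul] at h2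
  have h3 : ∫ s, h (x + s) * hpKernel y (x + s - x) =
      y * ∫ s, h (x + y * s) * hpKernel y (x + y * s - x) := by
    rw [h2]; field_simp
  rw [h3, ← integral_const_mul]
  congr 1; ext s
  have h0 : (1 + s ^ 2) ≠ 0 := by positivity
  have h0' : (y * s) ^ 2 + y ^ 2 ≠ 0 := by positivity
  rw [hpKernel, add_sub_cancel_left]
  have : y * (y / ((y * s) ^ 2 + y ^ 2)) = (1 + s ^ 2)⁻¹ := by
    field_simp
    ring
  rw [← this]; ring

theorem hpIntegral_mono {u v : ℝ → ℝ} (hu : Integrable fun t => u t * (1 + t ^ 2)⁻¹)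
    (hv : Integrable fun t => v t * (1 + t ^ 2)⁻¹) (huv : ∀ᵐ t, u t ≤ v t) {z : ℂ}
    (hz : 0 < z.im) : hpIntegral u z ≤ hpIntegral v z :=
  integral_mono_ae (integrable_mul_hpKernel hu hz _) (integrable_mul_hpKernel hv hz _)
    (huv.mono fun _ ht => mul_le_mul_of_nonneg_right ht (hpKernel_nonneg hz.le _))

theorem hpIntegral_const (b : ℝ) {z : ℂ} (hz : 0 < z.im) : hpIntegral (fun _ => b) z = b := by
  rw [hpIntegral, integral_const_mul, integral_hpKernel hz, mul_one]

theorem integrable_const_mul_inv_one_add_sq (b : ℝ) :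
    Integrable fun t : ℝ => b * (1 + t ^ 2)⁻¹ :=
  integrable_inv_one_add_sq.const_mul b

/-- The Poisson integral of a bounded continuous function extends continuously to the boundary. -/
theorem tendsto_hpIntegral_of_bounded {h : ℝ → ℝ} (hc : Continuous h) {b : ℝ}
    (hb : ∀ t, |h t| ≤ b) (x₀ : ℝ) :
    Tendsto (hpIntegral h) (𝓝[{z | 0 < z.im}] (x₀ : ℂ)) (𝓝 (h x₀)) := by
  have h1 : Tendsto (fun z : ℂ => ∫ s, h (z.re + z.im * s) * (Real.pi⁻¹ * (1 + s ^ 2)⁻¹))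
      (𝓝[{z | 0 < z.im}] (x₀ : ℂ)) (𝓝 (∫ s, h x₀ * (Real.pi⁻¹ * (1 + s ^ 2)⁻¹))) := by
    refine tendsto_integral_filter_of_dominated_convergence
      (fun s => b * (Real.pi⁻¹ * (1 + s ^ 2)⁻¹)) (Eventually.of_forall fun z => ?_)
      (Eventually.of_forall fun z => ae_of_all _ fun s => ?_)
      ((integrable_inv_one_add_sq.const_mul _).const_mul _) (ae_of_all _ fun s => ?_)
    · exact (Continuous.aestronglyMeasurable (by fun_prop)).mul
        (Measurable.aestronglyMeasurable (by fun_prop))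
    · rw [norm_mul, Real.norm_of_nonneg (show 0 ≤ Real.pi⁻¹ * (1 + s ^ 2)⁻¹ by positivity)]
      gcongr
      exact hb _
    · have : Continuous fun z : ℂ => h (z.re + z.im * s) * (Real.pi⁻¹ * (1 + s ^ 2)⁻¹) := by
        fun_prop
      have h2 := this.tendsto (x₀ : ℂ)
      simp only [Complex.ofReal_re, Complex.ofReal_im, zero_mul, add_zero] at h2
      exact h2.mono_left nhdsWithin_le_nhds
  rw [integral_const_mul, integral_const_mul, integral_univ_inv_one_add_sq,
    inv_mul_cancel₀ Real.pi_ne_zero, mul_one] at h1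
  refine h1.congr' ?_
  filter_upwards [self_mem_nhdsWithin] with z hz
  rw [hpIntegral, hpKernel_change hz]

/-- Lower semicontinuity up to the boundary of the Poisson integral of a continuous function
bounded from below. -/
theorem eventually_le_hpIntegral {w : ℝ → ℝ} (hc : Continuous w) {b : ℝ} (hb : ∀ t, b ≤ w t)
    (hw : Integrable fun t => w t * (1 + t ^ 2)⁻¹) (x₀ : ℝ) {ε : ℝ} (hε : 0 < ε) :
    ∀ᶠ z in 𝓝[{z | 0 < z.im}] (x₀ : ℂ), w x₀ - ε ≤ hpIntegral w z := by
  -- Truncating from above gives a bounded continuous minorant with the same value at `x₀`.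
  set h : ℝ → ℝ := fun t => min (w t) (w x₀) with hh
  have hbd : ∀ t, |h t| ≤ |b| + |w x₀| := by
    intro t
    have h1 : b ≤ h t := le_min (hb t) (hb x₀)
    have h2 : h t ≤ w x₀ := min_le_right _ _
    rw [abs_le]
    constructor
    · linarith [neg_abs_le b, abs_nonneg (w x₀)]
    · linarith [le_abs_self (w x₀), abs_nonneg b]
  have hhc : Continuous h := hc.min continuous_const
  have hhi : Integrable fun t => h t * (1 + t ^ 2)⁻¹ := by
    refine (integrable_const_mul_inv_one_add_sq (|b| + |w x₀|)).mono'
      (hhc.aestronglyMeasurable.mul (Measurable.aestronglyMeasurable (by fun_prop)))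
      (ae_of_all _ fun t => ?_)
    rw [norm_mul, Real.norm_of_nonneg (show 0 ≤ (1 + t ^ 2)⁻¹ by positivity)]
    gcongr
    exact hbd t
  have ht := tendsto_hpIntegral_of_bounded hhc hbd x₀
  have hx : h x₀ = w x₀ := min_self _
  rw [hx] at ht
  filter_upwards [ht.eventually (lt_mem_nhds (show w x₀ - ε < w x₀ by linarith)),
    self_mem_nhdsWithin] with z hz hzH
  exact hz.le.trans (hpIntegral_mono hhi hw (ae_of_all _ fun t => min_le_left _ _) hzH)

/-! ### Poisson majorants in the upper half-plane -/

/-- Poisson majorant: bound with `log (max |f| δ)`. -/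
theorem norm_le_exp_hpIntegral_log_max {f : ℂ → ℂ} (hd : DifferentiableOn ℂ f {z | 0 < z.im})
    (hcont : ContinuousOn f {z | 0 ≤ z.im}) {A R : ℝ}
    (hgrowth : ∀ z : ℂ, 0 ≤ z.im → R ≤ ‖z‖ → ‖f z‖ ≤ Real.exp (A * ‖z‖)) {k : ℝ}
    (hk : ∀ᶠ y : ℝ in atTop, ‖f (y * Complex.I)‖ ≤ Real.exp (k * y)) {δ : ℝ} (hδ : 0 < δ)
    (hint : Integrable fun t : ℝ => Real.log (max ‖f t‖ δ) * (1 + t ^ 2)⁻¹) {z : ℂ}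
    (hz : 0 < z.im) :
    ‖f z‖ ≤ Real.exp (k * z.im + hpIntegral (fun t => Real.log (max ‖f t‖ δ)) z) := by
  set w : ℝ → ℝ := fun t => Real.log (max ‖f t‖ δ) with hw
  have hmaxpos : ∀ t : ℝ, 0 < max ‖f t‖ δ := fun t => hδ.trans_le (le_max_right _ _)
  have hfc : Continuous fun t : ℝ => f t :=
    hcont.comp_continuous Complex.continuous_ofReal fun t => by simp
  have hwc : Continuous w := (hfc.norm.max continuous_const).log fun t => (hmaxpos t).ne'
  have hwb : ∀ t, Real.log δ ≤ w t := fun t => Real.log_le_log hδ (le_max_right _ _)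
  have hPb : ∀ z : ℂ, 0 < z.im → Real.log δ ≤ hpIntegral w z := fun z hz => by
    rw [← hpIntegral_const (Real.log δ) hz]
    exact hpIntegral_mono (integrable_const_mul_inv_one_add_sq _) hint (ae_of_all _ hwb) hz
  obtain ⟨W, hWd, hWre⟩ := exists_differentiableOn_re_eq_hpIntegral hint
  -- The factor has modulus `exp (-P[w] - k Im z)`, so the claim is `‖F‖ ≤ 1`. As `w ≥ log δ`, it
  -- costs at most `δ⁻¹` beyond `exp (-k Im z)`, which keeps `F` of exponential type.
  set F : ℂ → ℂ := fun z => f z * Complex.exp (-W z + Complex.I * k * z) with hF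
  have hFn : ∀ z : ℂ, 0 < z.im → ‖F z‖ = ‖f z‖ * Real.exp (-hpIntegral w z - k * z.im) := by
    intro z hz
    rw [hF]
    simp only
    rw [norm_mul, Complex.norm_exp, ← hWre z hz]
    congr 2
    simp
    ring
  obtain ⟨B, hB⟩ : ∃ B, ∀ z : ℂ, 0 ≤ z.im → ‖z‖ ≤ R → ‖f z‖ ≤ B := by
    have hcomp : IsCompact ({z : ℂ | 0 ≤ z.im} ∩ Metric.closedBall 0 R) :=
      (isCompact_closedBall 0 R).inter_left (isClosed_le continuous_const Complex.continuous_im)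
    obtain ⟨B, hB⟩ := hcomp.exists_bound_of_continuousOn (hcont.mono Set.inter_subset_left)
    exact ⟨B, fun z h1 h2 => hB z ⟨h1, by simpa using h2⟩⟩
  have hfg : ∀ z : ℂ, 0 ≤ z.im → ‖f z‖ ≤ (|B| + 1) * Real.exp (|A| * ‖z‖) := by
    intro z hz
    have hexp : 1 ≤ Real.exp (|A| * ‖z‖) := Real.one_le_exp (by positivity)
    rcases le_total ‖z‖ R with h | h
    · have := hB z hz h
      nlinarith [le_abs_self B, abs_nonneg B]
    · refine (hgrowth z hz h).trans ?_
      have h1 : Real.exp (A * ‖z‖) ≤ Real.exp (|A| * ‖z‖) := by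
        gcongr; exact le_abs_self A
      nlinarith [abs_nonneg B, Real.exp_pos (|A| * ‖z‖)]
  have hPexp : ∀ z : ℂ, 0 < z.im → Real.exp (-hpIntegral w z - k * z.im) ≤
      δ⁻¹ * Real.exp (-(k * z.im)) := by
    intro z hz
    rw [sub_eq_add_neg, Real.exp_add]
    gcongr
    rw [← Real.exp_log (inv_pos.2 hδ), Real.log_inv]
    exact Real.exp_le_exp.2 (by linarith [hPb z hz])
  have hgr : ∀ z : ℂ, 0 < z.im →
      ‖F z‖ ≤ (|B| + 1) * δ⁻¹ * Real.exp ((|A| + |k|) * ‖z‖) := by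
    intro z hz
    rw [hFn z hz]
    have h1 : Real.exp (-(k * z.im)) ≤ Real.exp (|k| * ‖z‖) := by
      refine Real.exp_le_exp.2 ?_
      have h2 : |k * z.im| ≤ |k| * ‖z‖ := by
        rw [abs_mul]; gcongr; exact Complex.abs_im_le_norm z
      linarith [neg_abs_le (k * z.im)]
    calc ‖f z‖ * Real.exp (-hpIntegral w z - k * z.im)
        ≤ ((|B| + 1) * Real.exp (|A| * ‖z‖)) * (δ⁻¹ * Real.exp (|k| * ‖z‖)) := by
          gcongr
          · exact hfg z hz.le
          · exact (hPexp z hz).trans (by gcongr)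
      _ = _ := by rw [add_mul |A| |k|, Real.exp_add]; ring
  have hFd : DifferentiableOn ℂ F {z | 0 < z.im} :=
    hd.mul ((hWd.neg.add (by fun_prop)).cexp)
  obtain ⟨Y, hY⟩ := eventually_atTop.1 hk
  have haxis : ∀ y : ℝ, 0 < y → ‖F (y * Complex.I)‖ ≤
      max δ⁻¹ ((|B| + 1) * δ⁻¹ * Real.exp ((|A| + |k|) * |Y|)) := by
    intro y hy
    have him : ((y : ℂ) * Complex.I).im = y := by simp
    have hpos : 0 < ((y : ℂ) * Complex.I).im := by rwa [him]
    rcases le_total Y y with h | h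
    · refine le_trans ?_ (le_max_left _ _)
      rw [hFn _ hpos]
      have h1 := hPexp _ hpos
      rw [him] at h1 ⊢
      calc _ ≤ Real.exp (k * y) * (δ⁻¹ * Real.exp (-(k * y))) := by
            gcongr; exact hY y h
        _ = δ⁻¹ := by
          rw [mul_left_comm, ← Real.exp_add, add_neg_cancel, Real.exp_zero, mul_one]
    · refine (hgr _ hpos).trans (le_trans ?_ (le_max_right _ _))
      have : ‖(y : ℂ) * Complex.I‖ ≤ |Y| := by
        rw [norm_mul, Complex.norm_I, mul_one, Complex.norm_real, Real.norm_of_nonneg hy.le]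
        exact h.trans (le_abs_self Y)
      gcongr
  have hbdry : ∀ x : ℝ, ∀ ε > 0, ∀ᶠ z in 𝓝[{z | 0 < z.im}] (x : ℂ), ‖F z‖ ≤ 1 + ε := by
    intro x ε hε
    -- Three errors share `log (1 + ε)`: continuity of `f`, the term `k Im z`, and semicontinuity of
    -- the Poisson integral.
    set η := Real.log (1 + ε) / 3 with hη
    have hη0 : 0 < η := div_pos (Real.log_pos (by linarith)) (by norm_num)
    have hle : 𝓝[{z : ℂ | 0 < z.im}] (x : ℂ) ≤ 𝓝[{z : ℂ | 0 ≤ z.im}] (x : ℂ) :=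
      nhdsWithin_mono _ fun z hz => show 0 ≤ z.im from le_of_lt hz
    have h1 : ∀ᶠ z in 𝓝[{z : ℂ | 0 < z.im}] (x : ℂ), ‖f z‖ < Real.exp (w x + η) := by
      have hx : ‖f x‖ < Real.exp (w x + η) := by
        refine lt_of_le_of_lt (le_max_left _ δ) ?_
        rw [← Real.exp_log (hmaxpos x)]
        exact Real.exp_lt_exp.2 (by simp only [hw]; linarith)
      have := (hcont (x : ℂ) (by simp)).norm
      exact hle (this.eventually (gt_mem_nhds hx))
    have h2 : ∀ᶠ z : ℂ in 𝓝[{z : ℂ | 0 < z.im}] (x : ℂ), -(k * z.im) < η := by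
      have hc : Continuous fun z : ℂ => -(k * z.im) := by fun_prop
      have := hc.tendsto (x : ℂ)
      simp only [Complex.ofReal_im, mul_zero, neg_zero] at this
      exact nhdsWithin_le_nhds (this.eventually (gt_mem_nhds hη0))
    filter_upwards [h1, h2, eventually_le_hpIntegral hwc hwb hint x hη0, self_mem_nhdsWithin]
      with z hz1 hz2 hz3 hzH
    rw [hFn z hzH]
    calc _ ≤ Real.exp (w x + η) * Real.exp (-(w x - η) + η) := by
          gcongr
          linarith
      _ = 1 + ε := by
          rw [← Real.exp_add, ← Real.exp_log (show 0 < 1 + ε by linarith)]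
          congr 1
          rw [hη]; ring
  have hfin := upperHalfPlane_norm_le_one_of_limsup hFd hgr haxis hbdry z hz
  rw [hFn z hz] at hfin
  rw [← div_le_one (Real.exp_pos _), div_eq_mul_inv, ← Real.exp_neg]
  rwa [show -(k * z.im + hpIntegral w z) = -hpIntegral w z - k * z.im by ring]

/-- Poisson majorant for functions of exponential type in the upper half-plane. -/
theorem norm_le_exp_hpIntegral {f : ℂ → ℂ} (hd : DifferentiableOn ℂ f {z | 0 < z.im})
    (hcont : ContinuousOn f {z | 0 ≤ z.im}) {A R : ℝ}
    (hgrowth : ∀ z : ℂ, 0 ≤ z.im → R ≤ ‖z‖ → ‖f z‖ ≤ Real.exp (A * ‖z‖)) {k : ℝ}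
    (hk : ∀ᶠ y : ℝ in atTop, ‖f (y * Complex.I)‖ ≤ Real.exp (k * y)) {u : ℝ → ℝ}
    (hu : Integrable fun t => u t * (1 + t ^ 2)⁻¹)
    (hfu : ∀ t : ℝ, ‖f t‖ ≤ Real.exp (u t)) {z : ℂ} (hz : 0 < z.im) :
    ‖f z‖ ≤ Real.exp (k * z.im + hpIntegral u z) := by
  have hfc : Continuous fun t : ℝ => f t :=
    hcont.comp_continuous Complex.continuous_ofReal fun t => by simp
  have hm2 : AEStronglyMeasurable (fun t : ℝ => (1 + t ^ 2)⁻¹) volume :=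
    Measurable.aestronglyMeasurable (by fun_prop)
  have hm : AEStronglyMeasurable u volume := by
    have h1 : AEStronglyMeasurable (fun t : ℝ => 1 + t ^ 2) volume := by fun_prop
    refine (hu.1.mul h1).congr (ae_of_all _ fun t => ?_)
    have : (1 + t ^ 2) ≠ 0 := by positivity
    simp [this]
  -- Truncation at `-n` matches `δ = exp (-n)`. It remains dominated by `|u|` and equals `u`
  -- pointwise for large `n`, so the truncation can be removed by dominated convergence.
  let v : ℕ → ℝ → ℝ := fun n t => max (u t) (-n)
  have hlog : ∀ (n : ℕ) (t : ℝ), Real.log (max ‖f t‖ (Real.exp (-n))) ≤ v n t := by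
    intro n t
    rw [Real.log_le_iff_le_exp (lt_of_lt_of_le (Real.exp_pos _) (le_max_right _ _))]
    refine max_le ((hfu t).trans (Real.exp_le_exp.2 (le_max_left _ _)))
      (Real.exp_le_exp.2 (le_max_right _ _))
  have hlog' : ∀ (n : ℕ) (t : ℝ), -(n : ℝ) ≤ Real.log (max ‖f t‖ (Real.exp (-n))) := by
    intro n t
    rw [Real.le_log_iff_exp_le (lt_of_lt_of_le (Real.exp_pos _) (le_max_right _ _))]
    exact le_max_right _ _
  have hv : ∀ (n : ℕ) t, |v n t| ≤ |u t| := by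
    intro n t
    have hn : (0 : ℝ) ≤ n := n.cast_nonneg
    simp only [v]
    rcases le_total (u t) (-n) with h | h
    · rw [max_eq_right h, abs_neg, abs_of_nonneg hn, abs_of_nonpos (by linarith)]; linarith
    · rw [max_eq_left h]
  have hvm : ∀ n, AEStronglyMeasurable (v n) volume := fun n =>
    hm.sup aestronglyMeasurable_const
  have hvi : ∀ n, Integrable fun t => v n t * (1 + t ^ 2)⁻¹ := fun n =>
    hu.mono ((hvm n).mul hm2) (ae_of_all _ fun t => by
      rw [norm_mul, norm_mul]; gcongr; exact hv n t)
  have hstep : ∀ n : ℕ, ‖f z‖ ≤ Real.exp (k * z.im + hpIntegral (v n) z) := by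
    intro n
    have hint : Integrable fun t : ℝ =>
        Real.log (max ‖f t‖ (Real.exp (-n))) * (1 + t ^ 2)⁻¹ := by
      refine ((integrable_const_mul_inv_one_add_sq n).add hu.norm).mono'
        (Continuous.aestronglyMeasurable ?_) (ae_of_all _ fun t => ?_)
      · refine ((hfc.norm.max continuous_const).log fun t =>
          (lt_of_lt_of_le (Real.exp_pos _) (le_max_right _ _)).ne').mul
          (Continuous.inv₀ (by fun_prop) fun t => by positivity)
      · have h0 : (0 : ℝ) ≤ (1 + t ^ 2)⁻¹ := by positivity
        simp only [Pi.add_apply]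
        rw [norm_mul, norm_mul, Real.norm_of_nonneg h0, ← add_mul]
        gcongr
        have hn : (0 : ℝ) ≤ n := n.cast_nonneg
        rw [Real.norm_eq_abs, Real.norm_eq_abs, abs_le]
        have h1 := hlog n t
        have h2 := hlog' n t
        have h3 := (abs_le.1 (hv n t)).2
        constructor <;> linarith [abs_nonneg (u t)]
    refine (norm_le_exp_hpIntegral_log_max hd hcont hgrowth hk (Real.exp_pos _) hint hz).trans ?_
    gcongr
    exact hpIntegral_mono hint (hvi n) (ae_of_all _ (hlog n)) hz
  have hlim : Tendsto (fun n => hpIntegral (v n) z) atTop (𝓝 (hpIntegral u z)) := by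
    refine tendsto_integral_of_dominated_convergence
      (fun t => ‖u t * hpKernel z.im (t - z.re)‖)
      (fun n => (hvm n).mul (Measurable.aestronglyMeasurable (by fun_prop)))
      (integrable_mul_hpKernel hu hz _).norm (fun n => ae_of_all _ fun t => ?_)
      (ae_of_all _ fun t => ?_)
    · rw [norm_mul, norm_mul]; gcongr; exact hv n t
    · refine tendsto_const_nhds.congr' ?_
      obtain ⟨N, hN⟩ := exists_nat_ge (-u t)
      filter_upwards [eventually_ge_atTop N] with n hn
      have : (N : ℝ) ≤ n := by exact_mod_cast hn
      simp only [v]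
      rw [max_eq_left (by linarith)]
  refine ge_of_tendsto' ((Real.continuous_exp.tendsto _).comp (hlim.const_add (k * z.im))) hstep

/-- Weighted bound of a function of exponential type by a Poisson integral of its boundary
values. -/
theorem ofReal_weight_mul_norm_le {f : ℂ → ℂ} (hd : DifferentiableOn ℂ f {z | 0 < z.im})
    (hcont : ContinuousOn f {z | 0 ≤ z.im}) {A R : ℝ}
    (hgrowth : ∀ z : ℂ, 0 ≤ z.im → R ≤ ‖z‖ → ‖f z‖ ≤ Real.exp (A * ‖z‖)) {k : ℝ}
    (hk : ∀ᶠ y : ℝ in atTop, ‖f (y * Complex.I)‖ ≤ Real.exp (k * y)) {G : ℝ → ℝ}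
    (hG : ∀ t, 0 < G t) (hGm : Measurable G)
    (hGi : Integrable fun t => Real.log (G t) * (1 + t ^ 2)⁻¹) {z : ℂ} (hz : 0 < z.im) {c : ℝ}
    (hc : Real.log (G z.re) - hpIntegral (fun t => Real.log (G t)) z ≤ c) :
    ENNReal.ofReal (G z.re * ‖f z‖) ≤ ENNReal.ofReal (Real.exp (k * z.im + c)) *
      ∫⁻ t : ℝ, ENNReal.ofReal (G t * ‖f t‖ * hpKernel z.im (t - z.re)) := by
  have hfc : Continuous fun t : ℝ => f t :=
    hcont.comp_continuous Complex.continuous_ofReal fun t => by simp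
  set q : ℝ → ℝ := fun t => G t * ‖f t‖ with hq
  have hq0 : ∀ t, 0 ≤ q t := fun t => mul_nonneg (hG t).le (norm_nonneg _)
  have hqm : Measurable q := hGm.mul hfc.norm.measurable
  have hP0 : ∀ t, 0 ≤ hpKernel z.im (t - z.re) := fun t => hpKernel_nonneg hz.le _
  by_cases hfin : ∫⁻ t : ℝ, ENNReal.ofReal (q t * hpKernel z.im (t - z.re)) = ∞
  · change _ ≤ _ * ∫⁻ t : ℝ, ENNReal.ofReal (q t * hpKernel z.im (t - z.re))
    rw [hfin, ENNReal.mul_top (ENNReal.ofReal_pos.2 (Real.exp_pos _)).ne']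
    exact le_top
  have hqP : Integrable fun t => q t * hpKernel z.im (t - z.re) := by
    refine ⟨(hqm.mul (by fun_prop)).aestronglyMeasurable, ?_⟩
    rw [hasFiniteIntegral_iff_ofReal (ae_of_all _ fun t => mul_nonneg (hq0 t) (hP0 t))]
    exact lt_top_iff_ne_top.2 hfin
  have hqi := integrable_mul_inv_of_hpKernel hz z.re hqP
  have hI : ∫⁻ t : ℝ, ENNReal.ofReal (q t * hpKernel z.im (t - z.re)) =
      ENNReal.ofReal (hpIntegral q z) :=
    (ofReal_integral_eq_lintegral_ofReal hqP
      (ae_of_all _ fun t => mul_nonneg (hq0 t) (hP0 t))).symm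
  have hI0 : 0 ≤ hpIntegral q z := integral_nonneg fun t => mul_nonneg (hq0 t) (hP0 t)
  change _ ≤ _ * ∫⁻ t : ℝ, ENNReal.ofReal (q t * hpKernel z.im (t - z.re))
  rw [hI, ← ENNReal.ofReal_mul (Real.exp_pos _).le]
  refine ENNReal.ofReal_le_ofReal ?_
  -- The shift by `ε` keeps the logarithm of `q + ε` integrable against the kernel, since `q` may
  -- vanish.
  have key : ∀ ε : ℝ, 0 < ε →
      G z.re * ‖f z‖ ≤ Real.exp (k * z.im + c) * (hpIntegral q z + ε) := by
    intro ε hε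
    have hlogint : Integrable fun t => Real.log (q t + ε) * (1 + t ^ 2)⁻¹ := by
      refine ((integrable_const_mul_inv_one_add_sq |Real.log ε|).add
        (hqi.const_mul ε⁻¹)).mono' (Measurable.aestronglyMeasurable (by fun_prop))
        (ae_of_all _ fun t => ?_)
      have h0 : (0 : ℝ) ≤ (1 + t ^ 2)⁻¹ := by positivity
      have h1 : Real.log ε ≤ Real.log (q t + ε) := Real.log_le_log hε (by linarith [hq0 t])
      have h2 : Real.log (q t + ε) ≤ Real.log ε + ε⁻¹ * q t := by
        have e : q t + ε = ε * (1 + ε⁻¹ * q t) := by field_simp; ring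
        have h3 : 0 ≤ ε⁻¹ * q t := mul_nonneg (inv_pos.2 hε).le (hq0 t)
        rw [e, Real.log_mul hε.ne' (by positivity)]
        have := Real.log_le_sub_one_of_pos (show 0 < 1 + ε⁻¹ * q t by positivity)
        linarith
      simp only [Pi.add_apply]
      rw [norm_mul, Real.norm_of_nonneg h0, ← mul_assoc, ← add_mul]
      gcongr
      rw [Real.norm_eq_abs, abs_le]
      have h3 : 0 ≤ ε⁻¹ * q t := mul_nonneg (inv_pos.2 hε).le (hq0 t)
      constructor
      · linarith [neg_abs_le (Real.log ε)]
      · linarith [le_abs_self (Real.log ε)]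
    have hu : Integrable fun t => (Real.log (q t + ε) - Real.log (G t)) * (1 + t ^ 2)⁻¹ := by
      refine (hlogint.sub hGi).congr (ae_of_all _ fun t => ?_)
      simp only [Pi.sub_apply]; ring
    have hfu : ∀ t : ℝ, ‖f t‖ ≤ Real.exp (Real.log (q t + ε) - Real.log (G t)) := by
      intro t
      rw [Real.exp_sub, Real.exp_log (by linarith [hq0 t]), Real.exp_log (hG t),
        le_div_iff₀ (hG t)]
      simp only [hq]; linarith
    have hmain := norm_le_exp_hpIntegral hd hcont hgrowth hk hu hfu hz
    have hsplit : hpIntegral (fun t => Real.log (q t + ε) - Real.log (G t)) z =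
        hpIntegral (fun t => Real.log (q t + ε)) z - hpIntegral (fun t => Real.log (G t)) z := by
      unfold hpIntegral
      rw [← integral_sub (integrable_mul_hpKernel hlogint hz _)
        (integrable_mul_hpKernel hGi hz _)]
      congr 1; ext t; ring
    set m := hpIntegral q z + ε with hm
    have hm0 : 0 < m := by linarith
    -- Jensen's inequality through the tangent line `log s ≤ log m + s/m - 1` at the mean `m` of `q
    -- + ε`.
    have hjensen : hpIntegral (fun t => Real.log (q t + ε)) z ≤ Real.log m := by
      have hri : Integrable fun t =>
          (m⁻¹ * q t + (Real.log m + m⁻¹ * ε - 1)) * (1 + t ^ 2)⁻¹ := by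
        refine ((hqi.const_mul m⁻¹).add
          (integrable_const_mul_inv_one_add_sq (Real.log m + m⁻¹ * ε - 1))).congr
          (ae_of_all _ fun t => ?_)
        simp only [Pi.add_apply]; ring
      refine (hpIntegral_mono hlogint hri (ae_of_all _ fun t => ?_) hz).trans (le_of_eq ?_)
      · have h1 : 0 < q t + ε := by linarith [hq0 t]
        have h2 := Real.log_le_sub_one_of_pos (div_pos h1 hm0)
        rw [Real.log_div h1.ne' hm0.ne', div_eq_inv_mul] at h2
        linarith
      · have : hpIntegral (fun t => m⁻¹ * q t + (Real.log m + m⁻¹ * ε - 1)) z =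
            m⁻¹ * hpIntegral q z + (Real.log m + m⁻¹ * ε - 1) := by
          unfold hpIntegral
          simp only [add_mul, mul_assoc]
          rw [integral_add (hqP.const_mul _) ((integrable_hpKernel hz _).const_mul _),
            integral_const_mul, integral_const_mul, integral_hpKernel hz, mul_one]
        rw [this]
        have : m⁻¹ * hpIntegral q z + m⁻¹ * ε = 1 := by
          rw [← mul_add, ← hm, inv_mul_cancel₀ hm0.ne']
        linarith
    calc G z.re * ‖f z‖ ≤ Real.exp (Real.log (G z.re)) * Real.exp (k * z.im +
          hpIntegral (fun t => Real.log (q t + ε) - Real.log (G t)) z) := by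
          rw [Real.exp_log (hG _)]
          exact mul_le_mul_of_nonneg_left hmain (hG _).le
      _ ≤ Real.exp (k * z.im + c) * Real.exp (Real.log m) := by
          rw [← Real.exp_add, ← Real.exp_add, hsplit]
          exact Real.exp_le_exp.2 (by linarith)
      _ = _ := by rw [Real.exp_log hm0]
  have hlim : Tendsto (fun ε : ℝ => Real.exp (k * z.im + c) * (hpIntegral q z + ε)) (𝓝[>] 0)
      (𝓝 (Real.exp (k * z.im + c) * hpIntegral q z)) := by
    have : Continuous fun ε : ℝ => Real.exp (k * z.im + c) * (hpIntegral q z + ε) := by fun_prop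
    have h := this.tendsto 0
    rw [add_zero] at h
    exact h.mono_left nhdsWithin_le_nhds
  exact ge_of_tendsto hlim (eventually_nhdsWithin_of_forall key)

/-! ### Integral estimates on the line -/

/-- Away from the origin `y/(t² + y²) ≤ 1/t² ≤ 2/(1 + t²)`. This replaces small heights by height
one, as the `max{r, 1}` in `S_g` requires. -/
theorem hpKernel_le_of_le_one {y : ℝ} (hy : 0 < y) (hy1 : y ≤ 1) {t : ℝ} (ht : 1 ≤ |t|) :
    hpKernel y t ≤ 2 * (Real.pi⁻¹ * (1 + t ^ 2)⁻¹) := by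
  have ht2 : 1 ≤ t ^ 2 := by rw [← sq_abs]; nlinarith
  rw [hpKernel, mul_left_comm]
  gcongr
  rw [← div_eq_mul_inv, div_le_div_iff₀ (by positivity) (by positivity)]
  nlinarith [sq_nonneg y]

/-- Poisson integrals at height at most `1` of a nonnegative function are controlled by its
supremum on `[-1, 1]` and its Poisson integral at height `1`. -/
theorem integral_mul_hpKernel_le_of_le_one {h : ℝ → ℝ} (h0 : ∀ t, 0 ≤ h t)
    (hi : Integrable fun t => h t * (1 + t ^ 2)⁻¹) {M : ℝ} (hM : ∀ t, |t| ≤ 1 → h t ≤ M)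
    {y : ℝ} (hy : 0 < y) (hy1 : y ≤ 1) :
    ∫ t, h t * hpKernel y t ≤ M + 2 * ∫ t, h t * (Real.pi⁻¹ * (1 + t ^ 2)⁻¹) := by
  have hM0 : 0 ≤ M := (h0 0).trans (hM 0 (by simp))
  have hi' : Integrable fun t => h t * (Real.pi⁻¹ * (1 + t ^ 2)⁻¹) := by
    refine (hi.const_mul Real.pi⁻¹).congr (ae_of_all _ fun t => ?_)
    simp only; ring
  have hk : Integrable fun t => hpKernel y t := by simpa using integrable_hpKernel hy 0
  have hk1 : ∫ t, hpKernel y t = 1 := by simpa using integral_hpKernel hy 0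
  have hhk : Integrable fun t => h t * hpKernel y t := by
    simpa using integrable_mul_hpKernel hi hy 0
  calc ∫ t, h t * hpKernel y t
      ≤ ∫ t, (M * hpKernel y t + 2 * (h t * (Real.pi⁻¹ * (1 + t ^ 2)⁻¹))) := by
        refine integral_mono hhk ((hk.const_mul M).add (hi'.const_mul 2)) fun t => ?_
        have hk0 := hpKernel_nonneg hy.le t
        have hp : 0 ≤ Real.pi⁻¹ * (1 + t ^ 2)⁻¹ := by positivity
        simp only
        rcases le_total |t| 1 with ht | ht
        · have := mul_le_mul_of_nonneg_right (hM t ht) hk0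
          have := mul_nonneg (h0 t) hp
          linarith
        · have := mul_le_mul_of_nonneg_left (hpKernel_le_of_le_one hy hy1 ht) (h0 t)
          have := mul_nonneg hM0 hk0
          linarith
    _ = _ := by
        rw [integral_add (hk.const_mul M) (hi'.const_mul 2), integral_const_mul,
          integral_const_mul, hk1, mul_one]

/-- Integrability against `(1 + t²)⁻¹` is preserved by contraction of the argument. -/
theorem integrable_comp_mul_of_pos {h : ℝ → ℝ} (hi : Integrable fun t => h t * (1 + t ^ 2)⁻¹)
    {y : ℝ} (hy : 0 < y) : Integrable fun s => h (y * s) * (Real.pi⁻¹ * (1 + s ^ 2)⁻¹) := by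
  have h1 : Integrable fun t => h t * hpKernel y t := by
    simpa using integrable_mul_hpKernel hi hy 0
  refine ((h1.comp_mul_left' hy.ne').const_mul y).congr (ae_of_all _ fun s => ?_)
  have : y * (y / ((y * s) ^ 2 + y ^ 2)) = (1 + s ^ 2)⁻¹ := by
    have h0 : (1 + s ^ 2) ≠ 0 := by positivity
    have h0' : (y * s) ^ 2 + y ^ 2 ≠ 0 := by positivity
    field_simp
    ring
  simp only [hpKernel]
  rw [← this]; ring

theorem summable_inv_one_add_sq : Summable fun l : ℕ => (1 + (l : ℝ) ^ 2)⁻¹ := by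
  have h := (summable_nat_add_iff 1).2 (Real.summable_one_div_nat_pow.2 one_lt_two)
  refine Summable.of_nonneg_of_le (fun l => by positivity) (fun l => ?_) (h.mul_left 2)
  rw [mul_one_div, inv_eq_one_div, div_le_div_iff₀ (by positivity) (by positivity)]
  push_cast
  nlinarith [sq_nonneg ((l : ℝ) - 1)]

/-- The integral test for `∑ h(l) / l²` when `h` does not vary too much on unit intervals. -/
theorem integrableOn_Ici_mul_inv_one_add_sq {h : ℝ → ℝ} (hm : Measurable h) (h0 : ∀ t, 0 ≤ h t)
    {c : ℝ} (hc : ∀ (l : ℕ) (t : ℝ), (l : ℝ) ≤ t → t ≤ l + 1 → h t ≤ c + h l)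
    (hs : Summable fun l : ℕ => h l / (l : ℝ) ^ 2) :
    IntegrableOn (fun t => h t * (1 + t ^ 2)⁻¹) (Set.Ici 0) := by
  have hc0 : 0 ≤ c := by simpa using hc 0 0 (by simp) (by simp)
  refine ⟨(hm.mul (by fun_prop)).aestronglyMeasurable, ?_⟩
  rw [hasFiniteIntegral_iff_ofReal (ae_of_all _ fun t => mul_nonneg (h0 t) (by positivity))]
  have hsub : Set.Ici (0 : ℝ) ⊆ ⋃ l : ℕ, Set.Ico (l : ℝ) (l + 1) := fun t ht =>
    Set.mem_iUnion.2 ⟨⌊t⌋₊, Nat.floor_le ht, Nat.lt_floor_add_one t⟩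
  -- The series in `hs` has zero term at `l = 0` because of division by zero; adding `h 0` to `c` in
  -- the majorant covers that term.
  have hsum : Summable fun l : ℕ => (c + h l) * (1 + (l : ℝ) ^ 2)⁻¹ := by
    refine Summable.of_nonneg_of_le (fun l => mul_nonneg (add_nonneg hc0 (h0 _)) (by positivity))
      (fun l => ?_) ((summable_inv_one_add_sq.mul_left (c + h 0)).add hs)
    rcases Nat.eq_zero_or_pos l with rfl | hl
    · simp
    · have hl' : (0 : ℝ) < l := by exact_mod_cast hl
      have h1 : h l * (1 + (l : ℝ) ^ 2)⁻¹ ≤ h l / (l : ℝ) ^ 2 := by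
        rw [div_eq_mul_inv]
        have := h0 l
        gcongr
        linarith
      have h2 : 0 ≤ h 0 * (1 + (l : ℝ) ^ 2)⁻¹ := mul_nonneg (h0 0) (by positivity)
      linarith
  calc ∫⁻ t in Set.Ici 0, ENNReal.ofReal (h t * (1 + t ^ 2)⁻¹)
      ≤ ∫⁻ t in ⋃ l : ℕ, Set.Ico (l : ℝ) (l + 1), ENNReal.ofReal (h t * (1 + t ^ 2)⁻¹) :=
        lintegral_mono_set hsub
    _ ≤ ∑' l : ℕ, ∫⁻ t in Set.Ico (l : ℝ) (l + 1), ENNReal.ofReal (h t * (1 + t ^ 2)⁻¹) :=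
        lintegral_iUnion_le _ _
    _ ≤ ∑' l : ℕ, ENNReal.ofReal ((c + h l) * (1 + (l : ℝ) ^ 2)⁻¹) := by
        refine ENNReal.tsum_le_tsum fun l => ?_
        refine (setLIntegral_mono (g := fun _ => ENNReal.ofReal ((c + h l) * (1 + (l : ℝ) ^ 2)⁻¹))
          measurable_const fun t ht => ENNReal.ofReal_le_ofReal ?_).trans ?_
        · have hl0 : (0 : ℝ) ≤ l := l.cast_nonneg
          have := hc l t ht.1 ht.2.le
          have := ht.1
          gcongr
          exact add_nonneg hc0 (h0 _)
        · rw [setLIntegral_const, Real.volume_Ico]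
          simp
    _ < ∞ := hsum.tsum_ofReal_lt_top

/-! ### The weight along rays and finiteness of `S_g` -/

section Weight

variable {n : ℕ} {g : EuclideanSpace ℝ (Fin n) → ℝ}

theorem IsLocallyBounded.exists_log_le (hg_one : ∀ x, 1 ≤ g x) (hg : IsLocallyBounded g) :
    ∃ M : ℝ, ∀ x, ‖x‖ ≤ 1 → Real.log (g x) ≤ M := by
  have h : ∃ B : ℝ, ∀ y ∈ Metric.closedBall (0 : EuclideanSpace ℝ (Fin n)) 1, |g y| ≤ B := by
    refine (isCompact_closedBall _ _).induction_on (p := fun s => ∃ B : ℝ, ∀ y ∈ s, |g y| ≤ B)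
      ⟨0, by simp⟩ (fun s t hst ⟨B, hB⟩ => ⟨B, fun y hy => hB y (hst hy)⟩)
      (fun s t ⟨B, hB⟩ ⟨B', hB'⟩ => ⟨max B B', fun y hy => ?_⟩) fun x _ => ?_
    · rcases hy with hy | hy
      · exact (hB y hy).trans (le_max_left _ _)
      · exact (hB' y hy).trans (le_max_right _ _)
    · obtain ⟨U, hU, B, hB⟩ := hg x
      exact ⟨U, mem_nhdsWithin_of_mem_nhds hU, B, hB⟩
  obtain ⟨B, hB⟩ := h
  refine ⟨Real.log B, fun x hx => Real.log_le_log (by linarith [hg_one x]) ?_⟩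
  exact (le_abs_self _).trans (hB x (by simpa using hx))

theorem log_add_le_of_submultiplicative (hg_one : ∀ x, 1 ≤ g x) {K : ℝ} (hK : 1 ≤ K)
    (hg : ∀ x y, g (x + y) ≤ K * g x * g y) (x y : EuclideanSpace ℝ (Fin n)) :
    Real.log (g (x + y)) ≤ Real.log K + Real.log (g x) + Real.log (g y) := by
  have h1 := hg_one x
  have h2 := hg_one y
  rw [← Real.log_mul (by positivity) (by positivity), ← Real.log_mul (by positivity) (by positivity)]
  exact Real.log_le_log (by linarith [hg_one (x + y)]) (hg x y)

theorem log_sum_le_of_submultiplicative (hg_one : ∀ x, 1 ≤ g x) {K : ℝ} (hK : 1 ≤ K)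
    (hg : ∀ x y, g (x + y) ≤ K * g x * g y) {ι : Type*} (s : Finset ι)
    (v : ι → EuclideanSpace ℝ (Fin n)) :
    Real.log (g (∑ j ∈ s, v j)) ≤
      Real.log (g 0) + ∑ j ∈ s, (Real.log K + Real.log (g (v j))) := by
  classical
  induction s using Finset.induction_on with
  | empty => simp
  | insert a s ha ih =>
    rw [Finset.sum_insert ha, Finset.sum_insert ha]
    have := log_add_le_of_submultiplicative hg_one hK hg (v a) (∑ j ∈ s, v j)
    linarith

/-- Submultiplicativity and boundedness on the unit ball let `log g` grow by at most `log K + M`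
from `l v` to `t v` with `l ≤ t ≤ l + 1`, so the Beurling–Domar series controls the integral. The
negative half-line uses the condition at `-v`. -/
theorem integrable_log_ray (hg_one : ∀ x, 1 ≤ g x) (hg_meas : Measurable g)
    (hg_bdd : IsLocallyBounded g) (hg_sub : IsSubmultiplicative g) (hg_BD : BeurlingDomar g)
    {v : EuclideanSpace ℝ (Fin n)} (hv : ‖v‖ ≤ 1) :
    Integrable fun τ : ℝ => Real.log (g (τ • v)) * (1 + τ ^ 2)⁻¹ := by
  obtain ⟨M, hM⟩ := hg_bdd.exists_log_le hg_one
  obtain ⟨K, hK, hsub⟩ := hg_sub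
  have key : ∀ v : EuclideanSpace ℝ (Fin n), ‖v‖ ≤ 1 →
      IntegrableOn (fun τ : ℝ => Real.log (g (τ • v)) * (1 + τ ^ 2)⁻¹) (Set.Ici 0) := by
    intro v hv
    refine integrableOn_Ici_mul_inv_one_add_sq (h := fun τ => Real.log (g (τ • v)))
      (c := Real.log K + M) (by fun_prop) (fun t => Real.log_nonneg (hg_one _))
      (fun l t h1 h2 => ?_) (hg_BD v)
    have h3 : ‖(t - l) • v‖ ≤ 1 := by
      rw [norm_smul, Real.norm_of_nonneg (by linarith)]
      exact mul_le_one₀ (by linarith) (norm_nonneg _) hv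
    have h4 := log_add_le_of_submultiplicative hg_one hK hsub ((t - l) • v) ((l : ℝ) • v)
    rw [← add_smul, sub_add_cancel] at h4
    linarith [hM _ h3]
  have h1 := key v hv
  have h2 := key (-v) (by simpa using hv)
  have h3 : IntegrableOn (fun τ : ℝ => Real.log (g (τ • v)) * (1 + τ ^ 2)⁻¹) (Set.Iic 0) := by
    have h4 := (Measure.measurePreserving_neg (volume : Measure ℝ)).integrableOn_comp_preimage
      (Homeomorph.neg ℝ).measurableEmbedding (s := Set.Ici 0)
      (f := fun τ : ℝ => Real.log (g (τ • -v)) * (1 + τ ^ 2)⁻¹)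
    have h5 := h4.2 h2
    simpa [Function.comp_def] using h5
  rw [← integrableOn_univ, ← Set.Iic_union_Ici (a := (0 : ℝ))]
  exact h3.union h1

/-- Integrability ray by ray gives no uniform bound. Log-subadditivity applied to `x = ∑ x_j e_j`
with `|x_j| ≤ 1` reduces every direction to contractions of basis rays. -/
theorem exists_integral_log_ray_le (hg_one : ∀ x, 1 ≤ g x) (hg_meas : Measurable g)
    (hg_bdd : IsLocallyBounded g) (hg_sub : IsSubmultiplicative g) (hg_BD : BeurlingDomar g) :
    ∃ D : ℝ, ∀ x : EuclideanSpace ℝ (Fin n), ‖x‖ = 1 →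
      ∫ τ : ℝ, Real.log (g (τ • x)) * (Real.pi⁻¹ * (1 + τ ^ 2)⁻¹) ≤ D := by
  have hray := fun v hv => integrable_log_ray hg_one hg_meas hg_bdd hg_sub hg_BD (v := v) hv
  obtain ⟨M, hM⟩ := hg_bdd.exists_log_le hg_one
  obtain ⟨K, hK, hsub⟩ := hg_sub
  let I : EuclideanSpace ℝ (Fin n) → ℝ := fun v =>
    ∫ τ : ℝ, Real.log (g (τ • v)) * (Real.pi⁻¹ * (1 + τ ^ 2)⁻¹)
  have hI0 : ∀ v, 0 ≤ I v := fun v =>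
    integral_nonneg fun τ => mul_nonneg (Real.log_nonneg (hg_one _)) (by positivity)
  have hker : Integrable fun τ : ℝ => Real.pi⁻¹ * (1 + τ ^ 2)⁻¹ :=
    integrable_inv_one_add_sq.const_mul _
  have hker1 : ∫ τ : ℝ, Real.pi⁻¹ * (1 + τ ^ 2)⁻¹ = 1 := by
    rw [integral_const_mul, integral_univ_inv_one_add_sq, inv_mul_cancel₀ Real.pi_ne_zero]
  -- Contracting a ray by `a` turns `I` into the Poisson integral at height `a ≤ 1`, bounded
  -- independently of `a`.
  have hpos : ∀ v : EuclideanSpace ℝ (Fin n), ‖v‖ ≤ 1 → ∀ a : ℝ, 0 < a → a ≤ 1 →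
      Integrable (fun τ : ℝ => Real.log (g (τ • a • v)) * (Real.pi⁻¹ * (1 + τ ^ 2)⁻¹)) ∧
      I (a • v) ≤ M + 2 * I v := by
    intro v hv a ha ha1
    have hcomm : ∀ τ : ℝ, τ • a • v = (a * τ) • v := fun τ => by rw [smul_smul, mul_comm]
    simp only [I, hcomm]
    refine ⟨integrable_comp_mul_of_pos (h := fun τ => Real.log (g (τ • v))) (hray v hv) ha, ?_⟩
    have h1 := hpKernel_change ha 0 fun τ => Real.log (g (τ • v))
    simp only [sub_zero, zero_add] at h1
    rw [← h1]
    refine integral_mul_hpKernel_le_of_le_one (h := fun τ => Real.log (g (τ • v)))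
      (fun t => Real.log_nonneg (hg_one _)) (hray v hv) (fun t ht => hM _ ?_) ha ha1
    rw [norm_smul]
    exact mul_le_one₀ ht (norm_nonneg _) hv
  have hM0 : 0 ≤ M := (Real.log_nonneg (hg_one 0)).trans (hM 0 (by simp))
  have hall : ∀ v : EuclideanSpace ℝ (Fin n), ‖v‖ ≤ 1 → ∀ a : ℝ, |a| ≤ 1 →
      Integrable (fun τ : ℝ => Real.log (g (τ • a • v)) * (Real.pi⁻¹ * (1 + τ ^ 2)⁻¹)) ∧
      I (a • v) ≤ M + 2 * I v + 2 * I (-v) := by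
    intro v hv a ha
    have h1 := hI0 v
    have h2 := hI0 (-v)
    rcases lt_trichotomy a 0 with h | rfl | h
    · have := hpos (-v) (by simpa using hv) (-a) (by linarith) (by rw [abs_of_neg h] at ha; exact ha)
      rw [neg_smul_neg] at this
      exact ⟨this.1, by linarith [this.2]⟩
    · simp only [zero_smul, smul_zero, I]
      refine ⟨hker.const_mul _, ?_⟩
      rw [integral_const_mul, hker1, mul_one]
      have := hM 0 (by simp)
      simp only [I] at h1 h2
      linarith
    · have := hpos v hv a h (by rw [abs_of_pos h] at ha; exact ha)
      exact ⟨this.1, by linarith [this.2]⟩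
  let e : Fin n → EuclideanSpace ℝ (Fin n) := fun j => EuclideanSpace.single j 1
  have he : ∀ j, ‖e j‖ ≤ 1 := fun j => by simp [e]
  refine ⟨Real.log (g 0) + ∑ j, (Real.log K + (M + 2 * I (e j) + 2 * I (-e j))), fun x hx => ?_⟩
  have hxj : ∀ j, |x j| ≤ 1 := fun j => by
    have := PiLp.norm_apply_le x j
    rw [hx] at this; exact this
  have hxsum : x = ∑ j, x j • e j := by
    ext i
    simp [e, Pi.single_apply]
  have hfun : ∀ τ : ℝ, Real.log (g (τ • x)) * (Real.pi⁻¹ * (1 + τ ^ 2)⁻¹) ≤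
      Real.log (g 0) * (Real.pi⁻¹ * (1 + τ ^ 2)⁻¹) +
      ∑ j, (Real.log K * (Real.pi⁻¹ * (1 + τ ^ 2)⁻¹) +
        Real.log (g (τ • x j • e j)) * (Real.pi⁻¹ * (1 + τ ^ 2)⁻¹)) := by
    intro τ
    have h1 := log_sum_le_of_submultiplicative hg_one hK hsub Finset.univ fun j => τ • x j • e j
    rw [← Finset.smul_sum, ← hxsum] at h1
    have h2 := mul_le_mul_of_nonneg_right h1
      (show 0 ≤ Real.pi⁻¹ * (1 + τ ^ 2)⁻¹ by positivity)
    rw [add_mul, Finset.sum_mul] at h2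
    simpa only [add_mul] using h2
  have hint : ∀ j, Integrable fun τ : ℝ => Real.log K * (Real.pi⁻¹ * (1 + τ ^ 2)⁻¹) +
        Real.log (g (τ • x j • e j)) * (Real.pi⁻¹ * (1 + τ ^ 2)⁻¹) := fun j =>
    (hker.const_mul _).add (hall (e j) (he j) (x j) (hxj j)).1
  have hintx : Integrable fun τ : ℝ => Real.log (g (τ • x)) * (Real.pi⁻¹ * (1 + τ ^ 2)⁻¹) := by
    refine ((hray x hx.le).const_mul Real.pi⁻¹).congr (ae_of_all _ fun t => ?_)
    simp only; ring
  refine (integral_mono hintx ((hker.const_mul _).add (integrable_finsetSum _ fun j _ => hint j))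
    hfun).trans ?_
  refine (integral_add (hker.const_mul _) (integrable_finsetSum _ fun j _ => hint j)).trans_le ?_
  rw [integral_const_mul, hker1, mul_one, integral_finsetSum _ fun j _ => hint j]
  gcongr with j
  rw [integral_add (hker.const_mul _) (hall (e j) (he j) (x j) (hxj j)).1, integral_const_mul,
    hker1, mul_one]
  gcongr
  exact (hall (e j) (he j) (x j) (hxj j)).2

theorem weightS_lt_top (hg_one : ∀ x, 1 ≤ g x) (hg_meas : Measurable g)
    (hg_bdd : IsLocallyBounded g) (hg_sub : IsSubmultiplicative g) (hg_BD : BeurlingDomar g) (r : ℝ) : weightS g r < ∞ := by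
  obtain ⟨D, hD⟩ := exists_integral_log_ray_le hg_one hg_meas hg_bdd hg_sub hg_BD
  have hray := fun v hv => integrable_log_ray hg_one hg_meas hg_bdd hg_sub hg_BD (v := v) hv
  refine lt_of_le_of_lt (iSup₂_le fun x hx => ?_) (ENNReal.ofReal_lt_top (r := D))
  have hx1 : ‖x‖ = 1 := by simpa using hx
  refine le_trans ?_ (ENNReal.ofReal_le_ofReal (hD x hx1))
  have hi : Integrable fun τ : ℝ => Real.log (g (τ • x)) * (Real.pi⁻¹ * (1 + τ ^ 2)⁻¹) := by
    refine ((hray x hx1.le).const_mul Real.pi⁻¹).congr (ae_of_all _ fun t => ?_)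
    simp only; ring
  rw [ofReal_integral_eq_lintegral_ofReal hi (ae_of_all _ fun τ =>
    mul_nonneg (Real.log_nonneg (hg_one _)) (by positivity)),
    ← lintegral_const_mul' _ _ ENNReal.ofReal_ne_top]
  refine lintegral_mono fun τ => ?_
  rw [← ENNReal.ofReal_mul (by positivity)]
  refine ENNReal.ofReal_le_ofReal ?_
  have h1 : 1 ≤ max r 1 := le_max_right _ _
  have h0 := Real.log_nonneg (hg_one (τ • x))
  rw [one_div, div_eq_mul_inv, mul_left_comm, add_comm (1 : ℝ)]
  gcongr
  nlinarith

theorem integral_log_ray_le_weightS (hg_one : ∀ x, 1 ≤ g x) (hg_meas : Measurable g)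
    (hg_bdd : IsLocallyBounded g) (hg_sub : IsSubmultiplicative g) (hg_BD : BeurlingDomar g)
    (r : ℝ) {x : EuclideanSpace ℝ (Fin n)} (hx : ‖x‖ = 1) :
    ∫ τ : ℝ, Real.log (g (τ • x)) * (Real.pi⁻¹ * (τ ^ 2 + max r 1 ^ 2)⁻¹) ≤
      (weightS g r).toReal := by
  have htop := weightS_lt_top hg_one hg_meas hg_bdd hg_sub hg_BD r
  rw [integral_eq_lintegral_of_nonneg_ae (ae_of_all _ fun τ =>
    mul_nonneg (Real.log_nonneg (hg_one _)) (by positivity))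
    (Measurable.aestronglyMeasurable (by fun_prop))]
  refine ENNReal.toReal_mono htop.ne ?_
  refine le_trans (le_of_eq ?_) (le_iSup₂_of_le (f := fun x (_ : x ∈ Metric.sphere
    (0 : EuclideanSpace ℝ (Fin n)) 1) => ENNReal.ofReal (1 / Real.pi) *
      ∫⁻ τ : ℝ, ENNReal.ofReal (Real.log (g (τ • x)) / (τ ^ 2 + max r 1 ^ 2)))
    x (by simpa using hx) le_rfl)
  rw [← lintegral_const_mul' _ _ ENNReal.ofReal_ne_top]
  congr 1; ext τ
  rw [← ENNReal.ofReal_mul (by positivity)]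
  congr 1
  ring

/-- For `y ≥ 1` the Poisson integral is at most `S_g(y) y` by definition of `S_g`. For `y ≤ 1` the
local bound `M` and height one take over and contribute only a constant. -/
theorem integral_log_ray_mul_hpKernel_le (hg_one : ∀ x, 1 ≤ g x) (hg_meas : Measurable g)
    (hg_bdd : IsLocallyBounded g) (hg_sub : IsSubmultiplicative g) (hg_BD : BeurlingDomar g)
    {M : ℝ} (hM : ∀ x, ‖x‖ ≤ 1 → Real.log (g x) ≤ M)
    {x : EuclideanSpace ℝ (Fin n)} (hx : ‖x‖ = 1) {y : ℝ} (hy : 0 < y) :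
    ∫ τ : ℝ, Real.log (g (τ • x)) * hpKernel y τ ≤
      M + 2 * (weightS g 1).toReal + (weightS g y).toReal * y := by
  have hray := integrable_log_ray hg_one hg_meas hg_bdd hg_sub hg_BD hx.le
  have hM0 : 0 ≤ M := (Real.log_nonneg (hg_one 0)).trans (hM 0 (by simp))
  have h1 := integral_log_ray_le_weightS hg_one hg_meas hg_bdd hg_sub hg_BD y hx
  have h2 := integral_log_ray_le_weightS hg_one hg_meas hg_bdd hg_sub hg_BD 1 hx
  have hS : 0 ≤ (weightS g 1).toReal := ENNReal.toReal_nonneg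
  have hSy : 0 ≤ (weightS g y).toReal := ENNReal.toReal_nonneg
  rcases le_total y 1 with hy1 | hy1
  · refine (integral_mul_hpKernel_le_of_le_one (h := fun τ => Real.log (g (τ • x)))
      (fun t => Real.log_nonneg (hg_one _)) hray (fun t ht => hM _ ?_) hy hy1).trans ?_
    · rw [norm_smul, hx, mul_one]; exact ht
    · simp only [max_self, one_pow, add_comm _ (1 : ℝ)] at h2
      have := mul_nonneg hSy hy.le
      linarith
  · rw [max_eq_left hy1] at h1
    have h3 : ∫ τ : ℝ, Real.log (g (τ • x)) * hpKernel y τ =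
        (∫ τ : ℝ, Real.log (g (τ • x)) * (Real.pi⁻¹ * (τ ^ 2 + y ^ 2)⁻¹)) * y := by
      rw [← integral_mul_const]
      congr 1; ext τ
      rw [hpKernel]; ring
    rw [h3]
    have := mul_le_mul_of_nonneg_right h1 hy.le
    linarith

end Weight

/-! ### Splitting off the first coordinate; oscillation of the weight -/

/-- The point of `ℝ^{m+1}` with first coordinate `t` and remaining coordinates `x'`. -/
noncomputable def euclideanCons {m : ℕ} (t : ℝ) (x' : Fin m → ℝ) :
    EuclideanSpace ℝ (Fin (m + 1)) := WithLp.toLp 2 (Fin.cons t x')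

@[simp]
theorem euclideanCons_zero_apply {m : ℕ} (t : ℝ) (x' : Fin m → ℝ) :
    euclideanCons t x' 0 = t := rfl

@[simp]
theorem euclideanCons_succ_apply {m : ℕ} (t : ℝ) (x' : Fin m → ℝ) (j : Fin m) :
    euclideanCons t x' j.succ = x' j := rfl

theorem euclideanCons_add {m : ℕ} (s t : ℝ) (x' : Fin m → ℝ) :
    euclideanCons (s + t) x' = s • euclideanCons 1 0 + euclideanCons t x' := by
  ext i
  refine Fin.cases ?_ (fun j => ?_) i <;> simp

theorem norm_euclideanCons_one_zero {m : ℕ} : ‖(euclideanCons 1 0 : EuclideanSpace ℝ (Fin (m + 1)))‖ = 1 := by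
  simp [EuclideanSpace.norm_eq, Fin.sum_univ_succ]

theorem measurePreserving_euclideanCons {m : ℕ} :
    MeasurePreserving (fun q : ℝ × (Fin m → ℝ) => euclideanCons q.1 q.2)
      (volume.prod volume) volume := by
  have h1 := (volume_preserving_piFinSuccAbove (fun _ : Fin (m + 1) => ℝ) 0).symm
  have h2 := (PiLp.volume_preserving_toLp (Fin (m + 1))).comp h1
  have h3 : (fun q : ℝ × (Fin m → ℝ) => euclideanCons q.1 q.2) = WithLp.toLp 2 ∘
      (MeasurableEquiv.piFinSuccAbove (fun _ : Fin (m + 1) => ℝ) 0).symm := by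
    funext q
    ext i
    refine Fin.cases ?_ (fun j => ?_) i <;> simp [MeasurableEquiv.piFinSuccAbove]
  rw [h3]
  exact h2

theorem measurePreserving_euclidean_uncons {m : ℕ} :
    MeasurePreserving (fun x : EuclideanSpace ℝ (Fin (m + 1)) => (x 0, fun j : Fin m => x j.succ))
      volume (volume.prod volume) := by
  have h1 := volume_preserving_piFinSuccAbove (fun _ : Fin (m + 1) => ℝ) 0
  exact h1.comp (PiLp.volume_preserving_ofLp (Fin (m + 1)))

/-- If the oscillation of `b` at `x` is controlled by `ℓ`, then `b x` exceeds the Poisson integral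
of `b` by at most the Poisson integral of `ℓ`. -/
theorem sub_hpIntegral_le {b ℓ : ℝ → ℝ} {κ : ℝ} {z : ℂ} (hz : 0 < z.im)
    (hb : Integrable fun t => b t * (1 + t ^ 2)⁻¹) (hℓ : Integrable fun t => ℓ t * (1 + t ^ 2)⁻¹)
    (h : ∀ t, b z.re - b t ≤ κ + ℓ (t - z.re)) :
    b z.re - hpIntegral b z ≤ κ + ∫ τ, ℓ τ * hpKernel z.im τ := by
  have hk := integrable_hpKernel hz z.re
  have hℓ0 : Integrable fun t => ℓ t * hpKernel z.im t := by
    simpa using integrable_mul_hpKernel hℓ hz 0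
  have hℓ1 : Integrable fun t => ℓ (t - z.re) * hpKernel z.im (t - z.re) := hℓ0.comp_sub_right z.re
  have hbi := integrable_mul_hpKernel hb hz z.re
  have h1 : ∫ τ, ℓ τ * hpKernel z.im τ = ∫ t, ℓ (t - z.re) * hpKernel z.im (t - z.re) :=
    (integral_sub_right_eq_self (fun t => ℓ t * hpKernel z.im t) z.re).symm
  have h2 : b z.re - hpIntegral b z = ∫ t, (b z.re * hpKernel z.im (t - z.re) -
      b t * hpKernel z.im (t - z.re)) := by
    rw [integral_sub (hk.const_mul _) hbi, integral_const_mul, integral_hpKernel hz, mul_one]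
    rfl
  have h3 : κ + ∫ τ, ℓ τ * hpKernel z.im τ = ∫ t, (κ * hpKernel z.im (t - z.re) +
      ℓ (t - z.re) * hpKernel z.im (t - z.re)) := by
    rw [integral_add (hk.const_mul _) hℓ1, integral_const_mul, integral_hpKernel hz, mul_one, h1]
  rw [h2, h3]
  refine integral_mono ((hk.const_mul _).sub hbi) ((hk.const_mul _).add hℓ1) fun t => ?_
  simp only
  rw [← sub_mul, ← add_mul]
  exact mul_le_mul_of_nonneg_right (h t) (hpKernel_nonneg hz.le _)

/-- The logarithm of the weight `g^{±1}` on a horizontal line is integrable against `(1 + t²)⁻¹`,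
and exceeds its Poisson integral by a bounded amount plus `S_g(y) y`. -/
theorem log_zpow_weight_sub_hpIntegral_le {m : ℕ} {g : EuclideanSpace ℝ (Fin (m + 1)) → ℝ}
    (hg_one : ∀ x, 1 ≤ g x) (hg_meas : Measurable g) (hg_bdd : IsLocallyBounded g)
    (hg_sub : IsSubmultiplicative g) (hg_BD : BeurlingDomar g) :
    ∃ c : ℝ, ∀ (s : ℤ), s = 1 ∨ s = -1 → ∀ x' : Fin m → ℝ,
      Integrable (fun t : ℝ => Real.log (g (euclideanCons t x') ^ s) * (1 + t ^ 2)⁻¹) ∧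
      ∀ z : ℂ, 0 < z.im → Real.log (g (euclideanCons z.re x') ^ s) -
        hpIntegral (fun t => Real.log (g (euclideanCons t x') ^ s)) z ≤
          c + (weightS g z.im).toReal * z.im := by
  obtain ⟨M, hM⟩ := hg_bdd.exists_log_le hg_one
  obtain ⟨K, hK, hsub⟩ := id hg_sub
  have hray := fun v hv => integrable_log_ray hg_one hg_meas hg_bdd hg_sub hg_BD (v := v) hv
  have hrayP := fun v hv y hy => integral_log_ray_mul_hpKernel_le hg_one hg_meas hg_bdd hg_sub
    hg_BD hM (x := v) hv (y := y) hy
  refine ⟨Real.log K + (M + 2 * (weightS g 1).toReal), fun s hs x' => ?_⟩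
  set v : EuclideanSpace ℝ (Fin (m + 1)) := euclideanCons 1 0 with hv
  have hv1 : ‖v‖ = 1 := norm_euclideanCons_one_zero
  have hv1' : ‖-v‖ = 1 := by rw [norm_neg, hv1]
  set a : ℝ → ℝ := fun t => Real.log (g (euclideanCons t x')) with ha
  have ha0 : ∀ t, 0 ≤ a t := fun t => Real.log_nonneg (hg_one _)
  -- The two points of the line differ by `(r - t) e₁`, so the bound does not depend on `x'`.
  have hosc : ∀ r t, a r ≤ Real.log K + Real.log (g ((r - t) • v)) + a t := by
    intro r t
    have := log_add_le_of_submultiplicative hg_one hK hsub ((r - t) • v) (euclideanCons t x')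
    rwa [hv, ← euclideanCons_add, sub_add_cancel] at this
  have ham : Measurable a := by
    have : Measurable fun t : ℝ => euclideanCons t x' :=
      measurePreserving_euclideanCons.measurable.comp (by fun_prop : Measurable fun t : ℝ => (t, x'))
    exact Real.measurable_log.comp (hg_meas.comp this)
  have hai : Integrable fun t => a t * (1 + t ^ 2)⁻¹ := by
    refine ((integrable_const_mul_inv_one_add_sq (Real.log K + a 0)).add (hray v hv1.le)).mono'
      (ham.mul (by fun_prop)).aestronglyMeasurable (ae_of_all _ fun t => ?_)
    have h0 : (0 : ℝ) ≤ (1 + t ^ 2)⁻¹ := by positivity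
    simp only [Pi.add_apply]
    rw [norm_mul, Real.norm_of_nonneg h0, Real.norm_of_nonneg (ha0 t), ← add_mul]
    gcongr
    have := hosc t 0
    rw [sub_zero] at this
    linarith
  -- For `g` the oscillation is governed by the ray in direction `-e₁`, for `g⁻¹` by that in
  -- direction `e₁`; the supremum in `S_g` covers both.
  rcases hs with rfl | rfl
  · simp only [zpow_one]
    refine ⟨hai, fun z hz => ?_⟩
    refine (sub_hpIntegral_le (b := a) (ℓ := fun τ => Real.log (g (τ • -v))) (κ := Real.log K) hz hai
      (hray (-v) hv1'.le) fun t => ?_).trans ?_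
    · have := hosc z.re t
      rw [smul_neg, ← neg_smul, neg_sub]
      linarith
    · have := hrayP (-v) hv1' z.im hz
      linarith
  · simp only [zpow_neg, zpow_one, Real.log_inv]
    have hneg : Integrable fun t => -a t * (1 + t ^ 2)⁻¹ := by simpa using hai.neg
    refine ⟨hneg, fun z hz => ?_⟩
    refine (sub_hpIntegral_le (b := fun t => -a t) (ℓ := fun τ => Real.log (g (τ • v)))
      (κ := Real.log K) hz hneg (hray v hv1.le) fun t => ?_).trans ?_
    · have := hosc t z.re
      linarith
    · have := hrayP v hv1 z.im hz
      linarith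

/-! ### `L^p` contraction, measurability and the limit in the exponent -/

/-- Jensen's inequality for the Poisson kernel and powers. -/
theorem lintegral_hpKernel_rpow_le {y : ℝ} (hy : 0 < y) (x : ℝ) {h : ℝ → ℂ} (hm : Measurable h)
    {r : ℝ} (hr : 1 ≤ r) :
    (∫⁻ t, ‖h t‖ₑ * ENNReal.ofReal (hpKernel y (t - x))) ^ r ≤
      ∫⁻ t, ‖h t‖ₑ ^ r * ENNReal.ofReal (hpKernel y (t - x)) := by
  have hPm : Measurable fun t => ENNReal.ofReal (hpKernel y (t - x)) := by fun_prop
  -- The kernel has mass one, so the inequality is monotonicity of `L^r` norms on a probability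
  -- space.
  set μ := volume.withDensity fun t => ENNReal.ofReal (hpKernel y (t - x)) with hμ
  have : IsProbabilityMeasure μ := ⟨by
    rw [hμ, withDensity_apply _ MeasurableSet.univ, Measure.restrict_univ, lintegral_hpKernel hy]⟩
  have hconv : ∀ f : ℝ → ℝ≥0∞, Measurable f →
      ∫⁻ t, f t * ENNReal.ofReal (hpKernel y (t - x)) = ∫⁻ t, f t ∂μ := by
    intro f hf
    rw [hμ, lintegral_withDensity_eq_lintegral_mul _ hPm hf]
    simp only [Pi.mul_apply, mul_comm]
  rw [hconv _ hm.enorm, hconv _ (hm.enorm.pow_const r)]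
  have h1 := eLpNorm'_le_eLpNorm'_of_exponent_le one_pos hr μ hm.aestronglyMeasurable
  rw [lintegral_rpow_enorm_eq_rpow_eLpNorm' (by linarith)]
  have h2 := lintegral_rpow_enorm_eq_rpow_eLpNorm' (μ := μ) (f := h) one_pos
  simp only [ENNReal.rpow_one] at h2
  rw [h2]
  gcongr

/-- A function dominated on almost every line by a multiple of the Poisson integral of another one
is dominated by it in `L^p`. -/
theorem eLpNorm_le_of_le_lintegral_hpKernel {X : Type*} [MeasurableSpace X] {ν : Measure X}
    [SFinite ν] {f₀ f₁ : ℝ × X → ℂ} (h₀ : AEStronglyMeasurable f₀ (volume.prod ν))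
    (h₁ : AEStronglyMeasurable f₁ (volume.prod ν))
    (hslice : ∀ᵐ x' ∂ν, Measurable fun t => f₀ (t, x')) {y : ℝ} (hy : 0 < y) {D : ℝ≥0∞}
    (hD : D ≠ ∞)
    (hle : ∀ᵐ x' ∂ν, ∀ x, ‖f₁ (x, x')‖ₑ ≤
      D * ∫⁻ t, ‖f₀ (t, x')‖ₑ * ENNReal.ofReal (hpKernel y (t - x))) {p : ℝ≥0∞} (hp : 1 ≤ p) :
    eLpNorm f₁ p (volume.prod ν) ≤ D * eLpNorm f₀ p (volume.prod ν) := by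
  rcases eq_or_ne p ∞ with rfl | hptop
  · rw [eLpNorm_exponent_top, eLpNorm_exponent_top]
    have h2 : ∀ᵐ x' ∂ν, ∀ᵐ t : ℝ, ‖f₀ (t, x')‖ₑ ≤ eLpNormEssSup f₀ (volume.prod ν) := by
      refine Measure.ae_ae_of_ae_prod (p := fun q : X × ℝ =>
        ‖f₀ (q.2, q.1)‖ₑ ≤ eLpNormEssSup f₀ (volume.prod ν)) ?_
      exact (Measure.measurePreserving_swap (μ := ν) (ν := (volume : Measure ℝ))).quasiMeasurePreserving.ae
        (enorm_ae_le_eLpNormEssSup f₀ _)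
    have h3 : ∀ᵐ x' ∂ν, ∀ x, ‖f₁ (x, x')‖ₑ ≤ D * eLpNormEssSup f₀ (volume.prod ν) := by
      filter_upwards [hle, h2] with x' h4 h5 x
      refine (h4 x).trans ?_
      gcongr
      calc _ ≤ ∫⁻ t, eLpNormEssSup f₀ (volume.prod ν) * ENNReal.ofReal (hpKernel y (t - x)) :=
            lintegral_mono_ae (h5.mono fun t ht => by gcongr)
        _ = _ := by
          rw [lintegral_const_mul _ (by fun_prop), lintegral_hpKernel hy, mul_one]
    refine eLpNormEssSup_le_of_ae_enorm_bound ?_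
    filter_upwards [Measure.quasiMeasurePreserving_snd.ae h3] with q hq
    exact hq q.1
  · have hp0 : p ≠ 0 := (one_pos.trans_le hp).ne'
    have hr : 1 ≤ p.toReal := by
      rw [← ENNReal.toReal_one]; exact ENNReal.toReal_mono hptop hp
    set r := p.toReal
    have hr0 : 0 < r := by linarith
    rw [eLpNorm_eq_lintegral_rpow_enorm_toReal hp0 hptop,
      eLpNorm_eq_lintegral_rpow_enorm_toReal hp0 hptop]
    have key : ∫⁻ q, ‖f₁ q‖ₑ ^ r ∂(volume.prod ν) ≤
        D ^ r * ∫⁻ q, ‖f₀ q‖ₑ ^ r ∂(volume.prod ν) := by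
      rw [lintegral_prod_symm _ (h₁.enorm.pow_const r), lintegral_prod_symm _ (h₀.enorm.pow_const r)]
      rw [← lintegral_const_mul' _ _ (ENNReal.rpow_ne_top_of_nonneg hr0.le hD)]
      refine lintegral_mono_ae ?_
      filter_upwards [hle, hslice] with x' h2 h3
      have hmeas : Measurable fun q : ℝ × ℝ =>
          ‖f₀ (q.2, x')‖ₑ ^ r * ENNReal.ofReal (hpKernel y (q.2 - q.1)) :=
        ((h3.comp measurable_snd).enorm.pow_const r).mul (by fun_prop)
      -- After Jensen, Tonelli's theorem integrates in `x` first, and the kernel, being symmetric in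
      -- `x` and `t`, again has mass one.
      calc ∫⁻ x, ‖f₁ (x, x')‖ₑ ^ r
          ≤ ∫⁻ x, D ^ r * ∫⁻ t, ‖f₀ (t, x')‖ₑ ^ r * ENNReal.ofReal (hpKernel y (t - x)) := by
            refine lintegral_mono fun x => ?_
            refine (ENNReal.rpow_le_rpow (h2 x) hr0.le).trans ?_
            rw [ENNReal.mul_rpow_of_nonneg _ _ hr0.le]
            gcongr
            exact lintegral_hpKernel_rpow_le hy x h3 hr
        _ = D ^ r * ∫⁻ t, ∫⁻ x, ‖f₀ (t, x')‖ₑ ^ r * ENNReal.ofReal (hpKernel y (t - x)) := by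
            rw [lintegral_const_mul' _ _ (ENNReal.rpow_ne_top_of_nonneg hr0.le hD),
              lintegral_lintegral_swap hmeas.aemeasurable]
        _ = _ := by
            congr 2; ext t
            rw [lintegral_const_mul _ (by fun_prop)]
            simp only [hpKernel_sub_comm y t]
            rw [lintegral_hpKernel hy, mul_one]
    calc _ ≤ (D ^ r * ∫⁻ q, ‖f₀ q‖ₑ ^ r ∂(volume.prod ν)) ^ (1 / r) := by gcongr
      _ = _ := by
        rw [ENNReal.mul_rpow_of_nonneg _ _ (by positivity), ← ENNReal.rpow_mul,
          mul_one_div_cancel hr0.ne', ENNReal.rpow_one]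

theorem measurePreserving_upperLines {X : Type*} [MeasurableSpace X] (ν : Measure X) [SFinite ν] :
    MeasurePreserving (fun q : ℝ × (ℝ × X) => ((q.2.1 : ℂ) + (q.1 : ℂ) * Complex.I, q.2.2))
      ((volume : Measure ℝ).prod ((volume : Measure ℝ).prod ν))
      ((volume : Measure ℂ).prod ν) := by
  have h1 := (measurePreserving_prodAssoc (volume : Measure ℝ) (volume : Measure ℝ) ν).symm
  have h2 : MeasurePreserving (Prod.map Prod.swap id : (ℝ × ℝ) × X → (ℝ × ℝ) × X)
      (((volume : Measure ℝ).prod volume).prod ν) (((volume : Measure ℝ).prod volume).prod ν) :=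
    Measure.measurePreserving_swap.prod (MeasurePreserving.id ν)
  have h3 : MeasurePreserving (Prod.map Complex.measurableEquivRealProd.symm id :
      (ℝ × ℝ) × X → ℂ × X) (((volume : Measure ℝ).prod volume).prod ν)
      ((volume : Measure ℂ).prod ν) :=
    (Complex.volume_preserving_equiv_real_prod.symm).prod (MeasurePreserving.id ν)
  have h4 := h3.comp (h2.comp h1)
  have h5 : (fun q : ℝ × (ℝ × X) => ((q.2.1 : ℂ) + (q.1 : ℂ) * Complex.I, q.2.2)) =
      Prod.map Complex.measurableEquivRealProd.symm id ∘ Prod.map Prod.swap id ∘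
        MeasurableEquiv.prodAssoc.symm := by
    funext q
    refine Prod.ext ?_ rfl
    apply Complex.ext <;> simp [Complex.measurableEquivRealProd, MeasurableEquiv.prodAssoc]
  rw [h5]
  exact h4

/-- A jointly measurable function on the half-plane times `X`, continuous in the first variable, is
measurable on every horizontal line times `X`. -/
theorem aestronglyMeasurable_upperLine {X : Type*} [MeasurableSpace X] {ν : Measure X} [SFinite ν]
    {φ : ℂ → X → ℂ}
    (hφ : AEStronglyMeasurable (fun q : ℂ × X => φ q.1 q.2)
      (((volume : Measure ℂ).prod ν).restrict {q | 0 ≤ q.1.im}))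
    (hc : ∀ᵐ x' ∂ν, ContinuousOn (fun z => φ z x') {z : ℂ | 0 ≤ z.im}) {y : ℝ} (hy : 0 < y) :
    AEStronglyMeasurable (fun q : ℝ × X => φ ((q.1 : ℂ) + (y : ℂ) * Complex.I) q.2)
      ((volume : Measure ℝ).prod ν) := by
  have hms : MeasurableSet {q : ℂ × X | 0 ≤ q.1.im} :=
    measurableSet_le measurable_const (Complex.measurable_im.comp measurable_fst)
  have h1 := hφ.comp_measurePreserving
    ((measurePreserving_upperLines ν).restrict_preimage hms)
  have hpre : (fun q : ℝ × (ℝ × X) => ((q.2.1 : ℂ) + (q.1 : ℂ) * Complex.I, q.2.2)) ⁻¹'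
      {q : ℂ × X | 0 ≤ q.1.im} = Set.Ici 0 ×ˢ Set.univ := by
    ext q; simp
  rw [hpre, ← Measure.prod_restrict, Measure.restrict_univ] at h1
  -- Fubini gives measurability only at almost every height. Such heights are dense, and continuity
  -- in the first variable transfers measurability to height `y` along a sequence.
  have h2 := (ae_restrict_iff' measurableSet_Ici).1 h1.prodMk_left
  have h3 := (Measure.dense_of_ae h2).open_subset_closure_inter (isOpen_Ioi (a := (0 : ℝ)))
  obtain ⟨u, hu, hlim⟩ := mem_closure_iff_seq_limit.1 (h3 hy)
  refine aestronglyMeasurable_of_tendsto_ae atTop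
    (f := fun k (q : ℝ × X) => φ ((q.1 : ℂ) + (u k : ℂ) * Complex.I) q.2)
    (fun k => (hu k).2 (Set.mem_Ici.2 (le_of_lt (Set.mem_Ioi.1 (hu k).1)))) ?_
  filter_upwards [Measure.quasiMeasurePreserving_snd.ae hc] with q hq
  have hpos : ∀ v : ℝ, 0 < v → (q.1 : ℂ) + (v : ℂ) * Complex.I ∈ {z : ℂ | 0 ≤ z.im} := by
    intro v hv; simpa using hv.le
  refine (hq _ (hpos y hy)).tendsto.comp (tendsto_nhdsWithin_iff.2 ⟨?_, Eventually.of_forall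
    fun k => hpos _ (hu k).1⟩)
  have : Continuous fun v : ℝ => (q.1 : ℂ) + (v : ℂ) * Complex.I := by fun_prop
  exact (this.tendsto y).comp hlim

theorem eventually_norm_le_of_limsup_log_lt {f : ℝ → ℂ} {k : ℝ}
    (h : limsup (fun y : ℝ => ENNReal.log ‖f y‖ₑ / (y : EReal)) atTop < k) :
    ∀ᶠ y : ℝ in atTop, ‖f y‖ ≤ Real.exp (k * y) := by
  filter_upwards [eventually_lt_of_limsup_lt h, eventually_gt_atTop 0] with y hy hy0
  have h1 := (EReal.div_le_iff_le_mul (EReal.coe_pos.2 hy0) (EReal.coe_ne_top y)).1 hy.le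
  rw [← EReal.coe_mul, ← EReal.log_exp (((y * k : ℝ)) : EReal), ENNReal.log_le_log_iff,
    EReal.exp_coe, ← ofReal_norm, ENNReal.ofReal_le_ofReal_iff (Real.exp_pos _).le,
    mul_comm] at h1
  exact h1

theorem wLpNorm_shiftRestrict_eq {m : ℕ} {ω : EuclideanSpace ℝ (Fin (m + 1)) → ℝ}
    (hω : Measurable ω) {φ : ℂ → (Fin m → ℝ) → ℂ} {y : ℝ} (p : ℝ≥0∞)
    (hφ : AEStronglyMeasurable (shiftRestrict φ y) volume) :
    AEStronglyMeasurable (fun q : ℝ × (Fin m → ℝ) => (ω (euclideanCons q.1 q.2) : ℂ) *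
      φ ((q.1 : ℂ) + (y : ℂ) * Complex.I) q.2) (volume.prod volume) ∧
    wLpNorm ω p (shiftRestrict φ y) =
      eLpNorm (fun q : ℝ × (Fin m → ℝ) => (ω (euclideanCons q.1 q.2) : ℂ) *
        φ ((q.1 : ℂ) + (y : ℂ) * Complex.I) q.2) p (volume.prod volume) := by
  have hω' : AEStronglyMeasurable (fun x => (ω x : ℂ)) volume :=
    (Complex.measurable_ofReal.comp hω).aestronglyMeasurable
  have h := hω'.mul hφ
  exact ⟨h.comp_measurePreserving measurePreserving_euclideanCons,
    (eLpNorm_comp_measurePreserving h measurePreserving_euclideanCons).symm⟩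

/-- A limit `k ↓ L`, or `k → -∞` when `L = ⊥`, where the right side becomes zero. Finiteness of `N₀`
excludes `0 · ∞` in that limit. -/
theorem mul_exp_mul_le_of_forall_lt {N₀ N₁ : ℝ≥0∞} (hN₀ : N₀ ≠ ∞) {L : EReal} (hL : L < ⊤) {c S y : ℝ}
    (hy : 0 < y)
    (h : ∀ k : ℝ, L < k → N₁ ≤ ENNReal.ofReal (Real.exp (k * y + (c + S * y))) * N₀) :
    N₁ ≤ ((Real.exp c).toNNReal : ℝ≥0∞) * EReal.exp ((L + (S : EReal)) * (y : EReal)) * N₀ := by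
  have hcont : Continuous fun k : ℝ => ENNReal.ofReal (Real.exp (k * y + (c + S * y))) :=
    ENNReal.continuous_ofReal.comp (by fun_prop)
  induction L with
  | top => exact absurd hL (lt_irrefl _)
  | bot =>
    have h1 : Tendsto (fun k : ℝ => ENNReal.ofReal (Real.exp (k * y + (c + S * y))) * N₀) atBot
        (𝓝 0) := by
      have h2 : Tendsto (fun k : ℝ => Real.exp (k * y + (c + S * y))) atBot (𝓝 0) :=
        Real.tendsto_exp_atBot.comp
          (tendsto_atBot_add_const_right _ _ (tendsto_id.atBot_mul_const hy))
      have h3 := ENNReal.Tendsto.mul_const (ENNReal.tendsto_ofReal h2) (Or.inr hN₀)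
      simpa using h3
    exact (ge_of_tendsto' h1 fun k => h k (EReal.bot_lt_coe k)).trans zero_le
  | coe L =>
    have h1 := ENNReal.Tendsto.mul_const
      ((hcont.tendsto L).mono_left (nhdsWithin_le_nhds (s := Set.Ioi L))) (Or.inr hN₀)
    have h2 := ge_of_tendsto h1 (eventually_nhdsWithin_of_forall fun k hk =>
      h k (EReal.coe_lt_coe_iff.2 hk))
    refine h2.trans (le_of_eq ?_)
    rw [← EReal.coe_add, ← EReal.coe_mul, EReal.exp_coe]
    change _ = ENNReal.ofReal (Real.exp c) * _ * _
    rw [← ENNReal.ofReal_mul (Real.exp_pos _).le, ← Real.exp_add]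
    congr 3
    ring

/-! ### The weighted estimate -/

theorem lemma3p1 {m : ℕ} (g : EuclideanSpace ℝ (Fin (m + 1)) → ℝ)
    (hg_one : ∀ x, 1 ≤ g x) (hg_meas : Measurable g) (hg_bdd : IsLocallyBounded g)
    (hg_sub : IsSubmultiplicative g) (hg_BD : BeurlingDomar g) :
    (∀ r : ℝ, weightS g r < ∞) ∧
    ∃ C : ℝ≥0, ∀ (p : ℝ≥0∞), 1 ≤ p →
      -- the sign `±` in `g^{±1}`
      ∀ (s : ℤ), s = 1 ∨ s = -1 →
      ∀ (φ : ℂ → (Fin m → ℝ) → ℂ),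
        -- `φ` is measurable on (closed upper half-plane) × ℝⁿ⁻¹
        AEStronglyMeasurable (fun q : ℂ × (Fin m → ℝ) => φ q.1 q.2)
          (volume.restrict {q : ℂ × (Fin m → ℝ) | 0 ≤ q.1.im}) →
        -- analytic in the open half-plane, continuous up to the real line
        (∀ᵐ x' : Fin m → ℝ, DifferentiableOn ℂ (fun z => φ z x') {z : ℂ | 0 < z.im} ∧
          ContinuousOn (fun z => φ z x') {z : ℂ | 0 ≤ z.im}) →
        -- `log |φ(z₁, x')| ≤ O(|z₁|)` for large `|z₁|`, `Im z₁ ≥ 0`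
        (∀ᵐ x' : Fin m → ℝ, ∃ A R : ℝ, ∀ z : ℂ, 0 ≤ z.im → R ≤ ‖z‖ →
          ‖φ z x'‖ ≤ Real.exp (A * ‖z‖)) →
        MemWLp (fun x => g x ^ s) p (shiftRestrict φ 0) →
        expType φ < ⊤ →
        ∀ y : ℝ, 0 < y →
          MemWLp (fun x => g x ^ s) p (shiftRestrict φ y) ∧
          wLpNorm (fun x => g x ^ s) p (shiftRestrict φ y) ≤
            (C : ℝ≥0∞) * EReal.exp ((expType φ + (weightS g y : EReal)) * (y : EReal)) *
              wLpNorm (fun x => g x ^ s) p (shiftRestrict φ 0) := by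
  have hS := weightS_lt_top hg_one hg_meas hg_bdd hg_sub hg_BD
  refine ⟨hS, ?_⟩
  obtain ⟨c, hc⟩ := log_zpow_weight_sub_hpIntegral_le hg_one hg_meas hg_bdd hg_sub hg_BD
  refine ⟨(Real.exp c).toNNReal, fun p hp s hs φ hφ hreg hgrowth hmem htype y hy => ?_⟩
  set ω : EuclideanSpace ℝ (Fin (m + 1)) → ℝ := fun x => g x ^ s with hω
  have hωm : Measurable ω := hg_meas.pow_const s
  have hω0 : ∀ x, 0 < ω x := fun x => zpow_pos (one_pos.trans_le (hg_one x)) s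
  have hconsm : ∀ x' : Fin m → ℝ, Measurable fun t : ℝ => euclideanCons t x' := fun x' =>
    measurePreserving_euclideanCons.measurable.comp (by fun_prop : Measurable fun t : ℝ => (t, x'))
  have hmeas : AEStronglyMeasurable (shiftRestrict φ y) volume :=
    (aestronglyMeasurable_upperLine hφ (hreg.mono fun x' h => h.2) hy).comp_measurePreserving
      measurePreserving_euclidean_uncons
  obtain ⟨h₁, hN₁⟩ := wLpNorm_shiftRestrict_eq hωm p hmeas
  obtain ⟨h₀, hN₀⟩ := wLpNorm_shiftRestrict_eq hωm p hmem.1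
  -- A real `k` strictly above `k_φ` is needed: only then does the upper limit give a genuine bound
  -- `exp (k y)` for large `y`, and `k_φ` may be `-∞`.
  have key : ∀ k : ℝ, expType φ < k → wLpNorm ω p (shiftRestrict φ y) ≤
      ENNReal.ofReal (Real.exp (k * y + (c + (weightS g y).toReal * y))) *
        wLpNorm ω p (shiftRestrict φ 0) := by
    intro k hk
    rw [hN₁, hN₀]
    have hlim : ∀ᵐ x' : Fin m → ℝ,
        limsup (fun y : ℝ => ENNReal.log ‖φ ((y : ℂ) * Complex.I) x'‖ₑ / (y : EReal)) atTop < k :=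
      (ae_le_essSup).mono fun x' h => lt_of_le_of_lt h hk
    refine eLpNorm_le_of_le_lintegral_hpKernel h₀ h₁ ?_ hy ENNReal.ofReal_ne_top ?_ hp
    · filter_upwards [hreg] with x' hx'
      have : Continuous fun t : ℝ => φ ((t : ℂ) + ((0 : ℝ) : ℂ) * Complex.I) x' :=
        hx'.2.comp_continuous (by fun_prop) fun t => by simp
      exact (Complex.measurable_ofReal.comp (hωm.comp (hconsm x'))).mul this.measurable
    · filter_upwards [hreg, hgrowth, hlim] with x' hx' ⟨A, R, hAR⟩ hlx x
      obtain ⟨hi, hle⟩ := hc s hs x'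
      set z : ℂ := (x : ℂ) + (y : ℂ) * Complex.I with hz
      have hre : z.re = x := by simp [hz]
      have him : z.im = y := by simp [hz]
      have hmain := ofReal_weight_mul_norm_le hx'.1 hx'.2 hAR
        (eventually_norm_le_of_limsup_log_lt hlx) (G := fun t => ω (euclideanCons t x'))
        (fun t => hω0 _) (hωm.comp (hconsm x')) hi (z := z) (by rwa [him])
        (hle z (by rwa [him]))
      rw [hre, him] at hmain
      have hen : ∀ (t : ℝ) (w : ℂ), ‖(ω (euclideanCons t x') : ℂ) * w‖ₑ =
          ENNReal.ofReal (ω (euclideanCons t x') * ‖w‖) := by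
        intro t w
        rw [← ofReal_norm, norm_mul, Complex.norm_real, Real.norm_of_nonneg (hω0 _).le]
      simp only [hen, Complex.ofReal_zero, zero_mul, add_zero]
      refine hmain.trans (le_of_eq ?_)
      congr 2; ext t
      rw [ENNReal.ofReal_mul (mul_nonneg (hω0 _).le (norm_nonneg _))]
  have hfin : wLpNorm ω p (shiftRestrict φ y) < ∞ := by
    obtain ⟨k, hk⟩ := EReal.lt_iff_exists_real_btwn.1 htype
    exact (key k hk.1).trans_lt (ENNReal.mul_lt_top ENNReal.ofReal_lt_top hmem.2)
  refine ⟨⟨hmeas, hfin⟩, ?_⟩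
  have hcast : (weightS g y : EReal) = ((weightS g y).toReal : EReal) :=
    (EReal.coe_ennreal_toReal (hS y).ne).symm
  rw [hcast]
  exact mul_exp_mul_le_of_forall_lt hmem.2.ne htype hy key
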